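/- Let $\Phi=(G,\varphi)$ be a complex unit gain graph: $G$ is a finite simple graph, and $\varphi$ assigns to each oriented edge $e_{ij}$ (from $v_i$ to $v_j$) a complex number of modulus $1$ with $\varphi(e_{ji})=\varphi(e_{ij})^{-1}$. Let $A(\Phi)$ be the matrix, indexed by the vertices, with $(i,j)$ entry $\varphi(e_{ij})$ if $v_iv_j\in E(G)$ and $0$ otherwise. Write $r(\Phi)$ for the rank of $A(\Phi)$, $r(G)$ for the rank of the ordinary adjacency matrix of $G$ (and similarly for other simple graphs), and $\theta(G)=|E(G)|-|V(G)|+\omega(G)$, where $\omega(G)$ is the number of connected components of $G$. Let $\mathcal C(G)$ be the set of cycles of $G$. A cycle $v_1v_2\cdots v_pv_1$ of $G$ is of Type B in $\Phi$ if $p$ is even and $\varphi(v_1v_2)\varphi(v_2v_3)\cdots\varphi(v_{p-1}v_p)\varphi(v_pv_1)\neq(-1)^{p/2}$. If the cycles of $G$ are pairwise vertex-disjoint, let $T_G$ be the simple graph obtained from $G$ by contracting each cycle $O$ of $G$ to a single vertex $t_O$: its vertices are the vertices of $G$ that lie on no cycle together with the vertices $t_O$, $O\in\mathcal C(G)$;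 two vertices lying on no cycle are adjacent in $T_G$ if and only if they are adjacent in $G$; a vertex $u$ lying on no cycle is adjacent to $t_O$ if and only if $u$ is adjacent in $G$ to some vertex of $O$; and $t_{O_1}$, $t_{O_2}$ with $O_1\ne O_2$ are adjacent if and only if some edge of $G$ joins a vertex of $O_1$ to a vertex of $O_2$. Let $\Gamma_G$ be the graph obtained from $T_G$ by deleting all the vertices $t_O$. **Theorem.** Suppose that $\Phi$ is upper-optimal, that is, $r(\Phi)=r(G)+2\theta(G)$. Then: (i) distinct cycles of $G$ (if any) have no common vertex; (ii) each cycle of $G$ is of Type B in $\Phi$ and its length is $\equiv 0 \pmod 4$; (iii) $r(G)=r(T_G)+\sum_{O\in\mathcal C(G)}(|V(O)|-2)$ and $r(T_G)=r(\Gamma_G)$. -/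

import Mathlib

namespace UnitGain

variable {V : Type*}

/-- A complex unit gain function on a simple graph `G`: each oriented edge gets a complex number
of modulus one, and reversing the orientation inverts it. Together with `G` this is a
complex unit gain graph `Φ = (G, φ)`. -/
structure GainFunction (G : SimpleGraph V) where
  /-- the gain of an oriented edge -/
  gain : G.Dart → Circle
  gain_symm : ∀ d : G.Dart, gain d.symm = (gain d)⁻¹

/-- The Hermitian adjacency matrix `A(Φ)`: the gain of the oriented edge `(i, j)` if `i` and `j`
are adjacent, and `0` otherwise. -/
noncomputable def GainFunction.adjMatrix {G : SimpleGraph V} (φ : GainFunction G) :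
    Matrix V V ℂ :=
  open Classical in
  Matrix.of fun i j => if h : G.Adj i j then ((φ.gain ⟨(i, j), h⟩ : Circle) : ℂ) else 0

/-- `r(Φ)`, the rank of `A(Φ)`. -/
noncomputable def GainFunction.rank [Finite V] {G : SimpleGraph V} (φ : GainFunction G) : ℕ :=
  letI : Fintype V := Fintype.ofFinite V
  φ.adjMatrix.rank

/-- `r(G)`, the rank of the `0`-`1` adjacency matrix of `G`. (Over any field of characteristic zero
the rank is the same; over `ℂ` it is literally `A(Φ)` for the gain function that is constantly `1`.) -/
noncomputable def graphRank [Finite V] (G : SimpleGraph V) : ℕ :=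
  letI : Fintype V := Fintype.ofFinite V
  open Classical in
  (G.adjMatrix ℂ).rank

/-- `θ(G) = |E(G)| - |V(G)| + ω(G)`, the dimension of the cycle space, where `ω(G)` is the number
of connected components. -/
noncomputable def cyclomaticNumber (G : SimpleGraph V) : ℤ :=
  (Nat.card G.edgeSet : ℤ) - (Nat.card V : ℤ) + (Nat.card G.ConnectedComponent : ℤ)

/-- `Φ` is upper-optimal if `r(Φ) = r(G) + 2 θ(G)`. -/
def GainFunction.IsUpperOptimal [Finite V] {G : SimpleGraph V} (φ : GainFunction G) : Prop :=
  (φ.rank : ℤ) = (graphRank G : ℤ) + 2 * cyclomaticNumber G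

/-- The product of the gains of the oriented edges along a walk. -/
noncomputable def GainFunction.walkGain {G : SimpleGraph V} (φ : GainFunction G) {u v : V}
    (c : G.Walk u v) : Circle :=
  (c.darts.map φ.gain).prod

/-- A gain cycle `C_n` (given by one of its traversals) is of Type B if `n` is even and its gain
differs from `(-1)^(n/2)`. -/
def GainFunction.IsTypeB {G : SimpleGraph V} (φ : GainFunction G) {v : V}
    (c : G.Walk v v) : Prop :=
  Even c.length ∧ ((φ.walkGain c : Circle) : ℂ) ≠ (-1) ^ (c.length / 2)

/-- `𝒞(G)`, the set of cycles of `G`, as subgraphs: all traversals of a cycle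
give the same element. -/
def cycles (G : SimpleGraph V) : Set G.Subgraph :=
  {O | ∃ (v : V) (c : G.Walk v v), c.IsCycle ∧ c.toSubgraph = O}

/-- `U`, the set of the vertices of `G` that lie on no cycle. -/
def offCycle (G : SimpleGraph V) : Set V :=
  {v | ∀ O ∈ cycles G, v ∉ O.verts}

/-- `T_G`: each cycle `O` of `G` is contracted into one vertex `t_O = Sum.inr O`; the other
vertices are the vertices of `G` on no cycle. (Used when the cycles of `G` are pairwise
vertex-disjoint.) -/
def contraction (G : SimpleGraph V) : SimpleGraph (offCycle G ⊕ cycles G) where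
  Adj
    | .inl u, .inl w => G.Adj u w
    | .inl u, .inr O => ∃ x ∈ O.1.verts, G.Adj u x
    | .inr O, .inl u => ∃ x ∈ O.1.verts, G.Adj u x
    | .inr O₁, .inr O₂ => O₁ ≠ O₂ ∧ ∃ x ∈ O₁.1.verts, ∃ y ∈ O₂.1.verts, G.Adj x y
  symm := ⟨by
    rintro (u | O) (w | P) h
    · exact G.adj_symm h
    · exact h
    · exact h
    · obtain ⟨hne, x, hx, y, hy, hxy⟩ := h
      exact ⟨hne.symm, y, hy, x, hx, G.adj_symm hxy⟩⟩
  loopless := ⟨by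
    rintro (u | O) h
    · exact G.irrefl h
    · exact h.1 rfl⟩

/-- `Γ_G`: the vertices `t_O` are deleted from `T_G`. -/
def contractionCore (G : SimpleGraph V) :
    SimpleGraph ((Set.range (Sum.inr : cycles G → offCycle G ⊕ cycles G))ᶜ : Set _) :=
  (contraction G).induce _

noncomputable instance [Finite V] (G : SimpleGraph V) : Fintype (cycles G) :=
  Fintype.ofFinite _

end UnitGain

namespace UnitGain

/-! ### Linear algebra: how the rank of a Hermitian matrix changes when a row and column are
cleared. -/

section LinearAlgebra

open Matrix Module

/-! Deleting a vertex of a cycle lowers θ by at least 1 and r(Φ) by at most 2, and does not raise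
r(G). By induction r(Φ) ≤ r(G) + 2θ(G), starting from forests, whose gains can be switched to 1. If
equality holds, every step is tight: for each cycle vertex v, r(G) = r(G−v), r(Φ) = r(Φ−v) + 2, θ(G)
= θ(G−v) + 1, and Φ−v is again upper-optimal (`UpperOptimal.isolate_of_isCyclicEmbedding`). Deleted
vertices are kept as isolated ones, which affects neither rank nor θ.

The exact drop of θ leaves no room for a second cycle through v, whence (i). The rank equalities
yield a kernel vector z of A(G) with z v = 1 and a vector k with k v = 0 and A(Φ)k = e_v. The
central lemma `UpperOptimal.boundary` truncates z to the component of G−v containing a neighbour y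
of v other than its two neighbours on the cycle. If G−v is bipartite, a sign symmetry forces z y =
0. Then deleting y lowers r(G) by 2, deleting the edge vy does not change r(G), and both deletions
keep upper-optimality.

Pruning in this way reduces (ii) to a cycle with no other edges at it, where the kernel equations
are explicit. By (ii) G is bipartite, so the central lemma is always available. It shows that
removing a cycle O costs |O| − 2 in r(G), and that removing the set B of outside neighbours of
cycles costs 2|B|. Comparing both orders gives r(Γ) = r(Γ−B) + 2|B|. Distinct cycles are never
adjacent, so T−B is Γ−B plus isolated vertices, and r(Γ) ≤ r(T) ≤ r(T−B) + 2|B| = r(Γ). -/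

theorem finrank_inf_ker_add_finrank_map {E F : Type*} [AddCommGroup E] [Module ℂ E]
    [FiniteDimensional ℂ E] [AddCommGroup F] [Module ℂ F] (N : Submodule ℂ E) (l : E →ₗ[ℂ] F) :
    finrank ℂ (N ⊓ LinearMap.ker l : Submodule ℂ E) + finrank ℂ (N.map l) = finrank ℂ N := by
  have h := (l.domRestrict N).finrank_range_add_finrank_ker
  have h1 : LinearMap.range (l.domRestrict N) = N.map l := by
    simp [LinearMap.domRestrict, LinearMap.range_comp]
  have h2 : (LinearMap.ker (l.domRestrict N)).map N.subtype = N ⊓ LinearMap.ker l := by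
    ext x
    simp [and_comm]
  rw [h1] at h
  rw [← h2, ← (Submodule.equivMapOfInjective _ N.subtype_injective _).finrank_eq]
  omega

theorem finrank_eq_add_one_of_exists_ne {E : Type*} [AddCommGroup E] [Module ℂ E]
    [FiniteDimensional ℂ E] (N : Submodule ℂ E) (l : E →ₗ[ℂ] ℂ) (h : ∃ z ∈ N, l z ≠ 0) :
    finrank ℂ N = finrank ℂ (N ⊓ LinearMap.ker l : Submodule ℂ E) + 1 := by
  obtain ⟨z, hz, hne⟩ := h
  have : N.map l = ⊤ := by
    rw [eq_top_iff]
    intro c _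
    exact ⟨(c / l z) • z, N.smul_mem _ hz, by simp [hne]⟩
  rw [← finrank_inf_ker_add_finrank_map N l, this]
  simp

theorem rank_submatrix_eq_of_support {m n : Type*} [Fintype m] [Fintype n]
    (M : Matrix n n ℂ) (f : m → n) (hf : Function.Injective f)
    (h : ∀ i j, M i j ≠ 0 → i ∈ Set.range f ∧ j ∈ Set.range f) :
    (M.submatrix f f).rank = M.rank := by
  classical
  refine le_antisymm (rank_submatrix_le _ _ _) ?_
  set F : Matrix n m ℂ := of fun i a => if i = f a then 1 else 0
  have : M = F * M.submatrix f f * Fᵀ := by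
    ext i j
    simp only [F, mul_apply, submatrix_apply, of_apply, transpose_apply]
    by_cases hi : ∃ a, f a = i
    · by_cases hj : ∃ b, f b = j
      · obtain ⟨a, rfl⟩ := hi
        obtain ⟨b, rfl⟩ := hj
        simp [hf.eq_iff]
      · rw [Finset.sum_eq_zero]
        · by_contra hne; exact hj (h i j hne).2
        · intro b _
          rw [if_neg (fun hb => hj ⟨b, hb.symm⟩), mul_zero]
    · rw [Finset.sum_eq_zero]
      · by_contra hne; exact hi (h i j hne).1
      · intro b _
        rw [Finset.sum_eq_zero, zero_mul]
        intro a _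
        rw [if_neg (fun hb => hi ⟨a, hb.symm⟩), zero_mul]
  conv_lhs => rw [this]
  exact (rank_mul_le_left _ _).trans (rank_mul_le_right _ _)

variable {V : Type*} [Fintype V]

theorem rank_add_finrank_ker (M : Matrix V V ℂ) :
    M.rank + finrank ℂ (LinearMap.ker M.mulVecLin) = Fintype.card V := by
  rw [Matrix.rank, LinearMap.finrank_range_add_finrank_ker]
  simp

theorem star_dotProduct_mulVec_comm {M : Matrix V V ℂ} (hM : M.IsHermitian) (x y : V → ℂ) :
    star x ⬝ᵥ (M *ᵥ y) = star (star y ⬝ᵥ (M *ᵥ x)) := by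
  rw [Matrix.star_dotProduct, star_mulVec, hM.eq, dotProduct_mulVec]

variable [DecidableEq V]

/-- The matrix with the row and the column of `w` replaced by zero. -/
def zeroCross (M : Matrix V V ℂ) (w : V) : Matrix V V ℂ :=
  of fun i j => if i = w ∨ j = w then 0 else M i j

theorem zeroCross_mulVec_of_eq_zero (M : Matrix V V ℂ) {w : V} {z : V → ℂ} (hz : z w = 0) (i : V) :
    (zeroCross M w *ᵥ z) i = if i = w then 0 else (M *ᵥ z) i := by
  simp only [mulVec, dotProduct, zeroCross, of_apply]
  split_ifs with h
  · simp [h]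
  · refine Finset.sum_congr rfl fun j _ => ?_
    by_cases hj : j = w
    · simp [hj, hz]
    · simp [h, hj]

theorem zeroCross_mulVec_self (M : Matrix V V ℂ) (w : V) : zeroCross M w *ᵥ Pi.single w 1 = 0 := by
  ext i
  simp [zeroCross]

/-- Let K be the part of the kernel of `zeroCross M w` where the coordinate at w vanishes; that
kernel is K plus the line of e_w. The vectors of ker M vanishing at w form a subspace of ker M (cut
out by z w = 0) and of K (cut out by (M z) w = 0), each of codimension at most 1. Hermitian symmetry
forbids both inclusions from being proper, which leaves three cases. -/
theorem rank_zeroCross_cases {M : Matrix V V ℂ} (hM : M.IsHermitian) (w : V) :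
    ((∃ z, M *ᵥ z = 0 ∧ z w ≠ 0) ∧ (¬ ∃ k, k w = 0 ∧ M *ᵥ k = Pi.single w 1) ∧
      M.rank = (zeroCross M w).rank) ∨
    ((¬ ∃ z, M *ᵥ z = 0 ∧ z w ≠ 0) ∧ (∃ k, k w = 0 ∧ M *ᵥ k = Pi.single w 1) ∧
      M.rank = (zeroCross M w).rank + 2) ∨
    ((¬ ∃ z, M *ᵥ z = 0 ∧ z w ≠ 0) ∧ (¬ ∃ k, k w = 0 ∧ M *ᵥ k = Pi.single w 1) ∧
      M.rank = (zeroCross M w).rank + 1) := by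
  have h1 := rank_add_finrank_ker M
  have h2 := rank_add_finrank_ker (zeroCross M w)
  set N := LinearMap.ker M.mulVecLin
  set N' := LinearMap.ker (zeroCross M w).mulVecLin
  set p : (V → ℂ) →ₗ[ℂ] ℂ := LinearMap.proj w
  set r : (V → ℂ) →ₗ[ℂ] ℂ := LinearMap.proj w ∘ₗ M.mulVecLin
  have h3 : finrank ℂ N' = finrank ℂ (N' ⊓ LinearMap.ker p : Submodule ℂ (V → ℂ)) + 1 := by
    refine finrank_eq_add_one_of_exists_ne _ _ ⟨Pi.single w 1, ?_, ?_⟩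
    · simpa [N'] using zeroCross_mulVec_self M w
    · simp [p]
  have h4 : (N' ⊓ LinearMap.ker p) ⊓ LinearMap.ker r = N ⊓ LinearMap.ker p := by
    ext z
    simp only [N, N', p, r, Submodule.mem_inf, LinearMap.mem_ker, mulVecLin_apply,
      LinearMap.proj_apply, LinearMap.comp_apply]
    constructor
    · rintro ⟨⟨ha, hb⟩, hc⟩
      refine ⟨funext fun i => ?_, hb⟩
      have := congrFun ha i
      rw [zeroCross_mulVec_of_eq_zero M hb] at this
      split_ifs at this with hi
      · rw [hi, hc]; rfl
      · exact this
    · rintro ⟨ha, hb⟩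
      refine ⟨⟨funext fun i => ?_, hb⟩, by rw [ha]; rfl⟩
      rw [zeroCross_mulVec_of_eq_zero M hb, ha]
      simp
  have key : ∀ k : V → ℂ, k ∈ N' ⊓ LinearMap.ker p ↔ k w = 0 ∧
      M *ᵥ k = Pi.single w ((M *ᵥ k) w) := by
    intro k
    simp only [N', p, Submodule.mem_inf, LinearMap.mem_ker, mulVecLin_apply, LinearMap.proj_apply]
    rw [and_comm]
    refine and_congr_right fun hk => ⟨fun h => funext fun i => ?_, fun h => funext fun i => ?_⟩
    · have := congrFun h i
      rw [zeroCross_mulVec_of_eq_zero M hk] at this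
      by_cases hi : i = w
      · rw [hi]; simp
      · simpa [hi] using this
    · rw [zeroCross_mulVec_of_eq_zero M hk]
      by_cases hi : i = w
      · simp [hi]
      · rw [h]; simp [hi]
  have hr : (∃ k ∈ N' ⊓ LinearMap.ker p, r k ≠ 0) ↔ ∃ k, k w = 0 ∧ M *ᵥ k = Pi.single w 1 := by
    constructor
    · rintro ⟨k, hk, hne⟩
      obtain ⟨hk0, hk1⟩ := (key k).1 hk
      have hne' : (M *ᵥ k) w ≠ 0 := hne
      refine ⟨((M *ᵥ k) w)⁻¹ • k, by simp [hk0], ?_⟩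
      rw [mulVec_smul, hk1]
      ext i
      by_cases hi : i = w
      · subst hi; simp [hne']
      · simp [hi]
    · rintro ⟨k, hk0, hk1⟩
      refine ⟨k, (key k).2 ⟨hk0, by rw [hk1]; simp⟩, ?_⟩
      simp [r, hk1]
  have hp : (∃ z ∈ N, p z ≠ 0) ↔ ∃ z, M *ᵥ z = 0 ∧ z w ≠ 0 := by
    simp [N, p]
  have hnot : (∃ z, M *ᵥ z = 0 ∧ z w ≠ 0) → ¬ ∃ k, k w = 0 ∧ M *ᵥ k = Pi.single w 1 := by
    rintro ⟨z, hz, hzw⟩ ⟨k, _, hk⟩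
    have := star_dotProduct_mulVec_comm hM z k
    rw [hz, hk] at this
    simp [hzw] at this
  have hA : (¬ ∃ z, M *ᵥ z = 0 ∧ z w ≠ 0) → N ⊓ LinearMap.ker p = N := by
    intro h
    rw [← hp] at h
    push Not at h
    exact inf_eq_left.2 fun z hz => h z hz
  have hB : (¬ ∃ k, k w = 0 ∧ M *ᵥ k = Pi.single w 1) →
      N ⊓ LinearMap.ker p = N' ⊓ LinearMap.ker p := by
    intro h
    rw [← hr] at h
    push Not at h
    rw [← h4]
    exact inf_eq_left.2 fun z hz => h z hz
  by_cases c1 : ∃ z, M *ᵥ z = 0 ∧ z w ≠ 0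
  · left
    have c2 := hnot c1
    refine ⟨c1, c2, ?_⟩
    have := finrank_eq_add_one_of_exists_ne N p (hp.2 c1)
    rw [hB c2] at this
    omega
  · right
    have h5 := hA c1
    by_cases c2 : ∃ k, k w = 0 ∧ M *ᵥ k = Pi.single w 1
    · left
      refine ⟨c1, c2, ?_⟩
      have := finrank_eq_add_one_of_exists_ne _ r (hr.2 c2)
      rw [h4, h5] at this
      omega
    · right
      refine ⟨c1, c2, ?_⟩
      have := hB c2
      rw [h5] at this
      rw [← this] at h3
      omega

theorem rank_zeroCross_le {M : Matrix V V ℂ} (hM : M.IsHermitian) (w : V) :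
    (zeroCross M w).rank ≤ M.rank := by
  rcases rank_zeroCross_cases hM w with h | h | h <;> omega

theorem rank_le_rank_zeroCross_add_two {M : Matrix V V ℂ} (hM : M.IsHermitian) (w : V) :
    M.rank ≤ (zeroCross M w).rank + 2 := by
  rcases rank_zeroCross_cases hM w with h | h | h <;> omega

theorem rank_eq_rank_zeroCross_iff {M : Matrix V V ℂ} (hM : M.IsHermitian) (w : V) :
    M.rank = (zeroCross M w).rank ↔ ∃ z, M *ᵥ z = 0 ∧ z w ≠ 0 := by
  rcases rank_zeroCross_cases hM w with h | h | h <;> simp only [h] <;> simp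

theorem rank_eq_rank_zeroCross_add_two_iff {M : Matrix V V ℂ} (hM : M.IsHermitian) (w : V) :
    M.rank = (zeroCross M w).rank + 2 ↔ ∃ k, k w = 0 ∧ M *ᵥ k = Pi.single w 1 := by
  rcases rank_zeroCross_cases hM w with h | h | h <;> simp only [h] <;> simp

end LinearAlgebra

/-! ### Graph theory: vertex isolation, cyclic indexing of cycles, the cyclomatic number,
potentials. -/

section GraphTheory

open SimpleGraph

variable {V : Type*}

/-- The graph obtained by deleting all edges at the vertices of `s`. -/
def isolate (s : Set V) (H : SimpleGraph V) : SimpleGraph V where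
  Adj a b := H.Adj a b ∧ a ∉ s ∧ b ∉ s
  symm := ⟨fun _ _ h => ⟨h.1.symm, h.2.2, h.2.1⟩⟩
  loopless := ⟨fun _ h => H.irrefl h.1⟩

theorem isolate_adj {s : Set V} {H : SimpleGraph V} {a b : V} :
    (isolate s H).Adj a b ↔ H.Adj a b ∧ a ∉ s ∧ b ∉ s := Iff.rfl

theorem isolate_le (s : Set V) (H : SimpleGraph V) : isolate s H ≤ H := fun _ _ h => h.1

theorem isolate_isolate (s t : Set V) (H : SimpleGraph V) :
    isolate s (isolate t H) = isolate (t ∪ s) H := by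
  ext a b
  simp only [isolate_adj, Set.mem_union]
  tauto

theorem isolate_empty (H : SimpleGraph V) : isolate ∅ H = H := by
  ext a b
  simp [isolate_adj]

theorem isolate_mono (s : Set V) {H K : SimpleGraph V} (h : H ≤ K) : isolate s H ≤ isolate s K :=
  fun _ _ hab => ⟨h hab.1, hab.2⟩

theorem reachable_sup_edge {H : SimpleGraph V} {u v x y : V}
    (h : (H ⊔ edge u v).Reachable x y) :
    H.Reachable x y ∨ (H.Reachable x u ∧ H.Reachable v y) ∨
      (H.Reachable x v ∧ H.Reachable u y) := by
  obtain ⟨p⟩ := h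
  induction p with
  | nil => exact Or.inl (Reachable.refl _)
  | @cons a b c hab p ih =>
    rcases hab with hab | hab
    · have hr := hab.reachable
      rcases ih with h | h | h
      · exact Or.inl (hr.trans h)
      · exact Or.inr (Or.inl ⟨hr.trans h.1, h.2⟩)
      · exact Or.inr (Or.inr ⟨hr.trans h.1, h.2⟩)
    · rw [edge_adj] at hab
      rcases hab.1 with ⟨rfl, rfl⟩ | ⟨rfl, rfl⟩
      · rcases ih with h | h | h
        · exact Or.inr (Or.inl ⟨Reachable.refl _, h⟩)
        · exact Or.inr (Or.inl ⟨Reachable.refl _, h.2⟩)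
        · exact Or.inl h.2
      · rcases ih with h | h | h
        · exact Or.inr (Or.inr ⟨Reachable.refl _, h⟩)
        · exact Or.inl h.2
        · exact Or.inr (Or.inr ⟨Reachable.refl _, h.2⟩)

theorem sup_edge_le {H K : SimpleGraph V} {u v : V} (h : H ≤ K) (huv : K.Adj u v) :
    H ⊔ edge u v ≤ K := by
  refine sup_le h fun a b hab => ?_
  rw [edge_adj] at hab
  rcases hab.1 with ⟨rfl, rfl⟩ | ⟨rfl, rfl⟩
  · exact huv
  · exact huv.symm

/-- An injective cyclic sequence of at least three vertices, consecutive ones adjacent. -/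
structure IsCyclicEmbedding (H : SimpleGraph V) {n : ℕ} (f : ZMod n → V) : Prop where
  three_le : 3 ≤ n
  injective : Function.Injective f
  adj : ∀ i, H.Adj (f i) (f (i + 1))

/-- Indexing by `ZMod` puts all vertices of the cycle on an equal footing; the last clause carries
gains of walks over to products around the cycle. -/
theorem exists_isCyclicEmbedding {H : SimpleGraph V} {v : V} (c : H.Walk v v) (hc : c.IsCycle) :
    ∃ f : ZMod c.length → V, IsCyclicEmbedding H f ∧ c.toSubgraph.verts = Set.range f ∧
      (∀ a b, c.toSubgraph.Adj a b ↔ ∃ i, s(f i, f (i + 1)) = s(a, b)) ∧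
      ∀ {A : Type} [CommMonoid A] [NeZero c.length] (W : V → V → A),
        (c.darts.map fun d => W d.fst d.snd).prod = ∏ i, W (f i) (f (i + 1)) := by
  have h3 := hc.three_le_length
  have : NeZero c.length := ⟨by omega⟩
  have hsucc : ∀ i : ZMod c.length, c.getVert (i + 1).val = c.getVert (i.val + 1) := by
    intro i
    have hi := i.val_lt
    rw [ZMod.val_add, ZMod.val_one'' (by omega)]
    rcases Nat.lt_or_ge (i.val + 1) c.length with hlt | hge
    · rw [Nat.mod_eq_of_lt hlt]
    · have : i.val + 1 = c.length := by omega
      rw [this, Nat.mod_self, c.getVert_zero, c.getVert_length]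
  refine ⟨fun i => c.getVert i.val, ⟨h3, ?_, ?_⟩, ?_, ?_, ?_⟩
  · intro i j hij
    have hi := i.val_lt
    have hj := j.val_lt
    exact ZMod.val_injective _
      (hc.getVert_injOn' (by simp only [Set.mem_ofPred_eq]; omega)
        (by simp only [Set.mem_ofPred_eq]; omega) hij)
  · intro i
    simp only [hsucc]
    exact c.adj_getVert_succ i.val_lt
  · ext x
    rw [Walk.mem_verts_toSubgraph, Walk.mem_support_iff_exists_getVert]
    constructor
    · rintro ⟨k, rfl, hk⟩
      rcases hk.lt_or_eq with hk | rfl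
      · exact ⟨(k : ZMod c.length), by simp only [ZMod.val_natCast_of_lt hk]⟩
      · exact ⟨0, by simp⟩
    · rintro ⟨i, rfl⟩
      exact ⟨i.val, rfl, i.val_lt.le⟩
  · intro a b
    rw [Walk.toSubgraph_adj_iff]
    simp only [hsucc]
    constructor
    · rintro ⟨k, hk, hlt⟩
      exact ⟨(k : ZMod c.length), by simpa only [ZMod.val_natCast_of_lt hlt] using hk⟩
    · rintro ⟨i, hi⟩
      exact ⟨i.val, hi, i.val_lt⟩
  · intro A _ _ W
    rw [← Fin.prod_univ_fun_getElem]
    refine Fintype.prod_bijective (fun i : Fin c.darts.length => ((i : ℕ) : ZMod c.length))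
      ?_ _ _ ?_
    · have hlen := c.length_darts
      constructor
      · intro i j hij
        have hi := i.2
        have hj := j.2
        have := congrArg ZMod.val hij
        simp only at this
        rw [ZMod.val_natCast_of_lt (by omega), ZMod.val_natCast_of_lt (by omega)] at this
        exact Fin.ext this
      · intro i
        exact ⟨⟨i.val, by rw [hlen]; exact i.val_lt⟩, by simp⟩
    · intro i
      have hi : (i : ℕ) < c.length := by rw [← c.length_darts]; exact i.2
      simp only [hsucc, ZMod.val_natCast_of_lt hi]
      simp [Walk.darts_getElem_eq_getVert]

variable [Finite V]

theorem card_edgeSet_sup_edge {H : SimpleGraph V} {u v : V} (huv : u ≠ v) (hn : ¬ H.Adj u v) :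
    Nat.card (H ⊔ edge u v).edgeSet = Nat.card H.edgeSet + 1 := by
  have : (H ⊔ edge u v).edgeSet = insert s(u, v) H.edgeSet := by
    rw [edgeSet_sup, edgeSet_edge_of_ne huv, Set.union_comm]
    rfl
  rw [this, Nat.card_coe_set_eq, Nat.card_coe_set_eq, Set.ncard_insert_of_notMem]
  exact hn

theorem card_connectedComponent_le_sup_edge_add_one (H : SimpleGraph V) (u v : V) :
    Nat.card H.ConnectedComponent ≤ Nat.card (H ⊔ edge u v).ConnectedComponent + 1 := by
  classical
  -- Only the components of u and v can merge; `none` takes the component of v out of the way.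
  let g : H.ConnectedComponent → Option (H ⊔ edge u v).ConnectedComponent := fun C =>
    if C = H.connectedComponentMk v then none else some (C.map (Hom.ofLE le_sup_left))
  have hg : Function.Injective g := by
    intro C D
    induction C using ConnectedComponent.ind with | _ x => ?_
    induction D using ConnectedComponent.ind with | _ y => ?_
    simp only [g, ConnectedComponent.map_mk, Hom.coe_ofLE, id]
    split_ifs with h1 h2 h2
    · intro _; rw [h1, h2]
    · intro h; simp at h
    · intro h; simp at h
    · intro h
      rw [Option.some_inj, ConnectedComponent.eq] at h
      rw [ConnectedComponent.eq] at h1 h2 ⊢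
      rcases reachable_sup_edge h with h | h | h
      · exact h
      · exact absurd h.2.symm h2
      · exact absurd h.1 h1
  have := Nat.card_le_card_of_injective g hg
  rwa [Finite.card_option] at this

theorem card_connectedComponent_le_sup_edge_of_reachable {H : SimpleGraph V} {u v : V}
    (h : H.Reachable u v) :
    Nat.card H.ConnectedComponent ≤ Nat.card (H ⊔ edge u v).ConnectedComponent := by
  refine Nat.card_le_card_of_injective
    (fun C : H.ConnectedComponent => C.map (Hom.ofLE (le_sup_left : H ≤ H ⊔ edge u v))) ?_
  intro C D
  induction C using ConnectedComponent.ind with | _ x => ?_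
  induction D using ConnectedComponent.ind with | _ y => ?_
  simp only [ConnectedComponent.map_mk, Hom.coe_ofLE, id, ConnectedComponent.eq]
  intro hxy
  rcases reachable_sup_edge hxy with h' | h' | h'
  · exact h'
  · exact h'.1.trans (h.trans h'.2)
  · exact h'.1.trans (h.symm.trans h'.2)

theorem cyclomaticNumber_le_sup_edge {H : SimpleGraph V} {u v : V} (huv : u ≠ v)
    (hn : ¬ H.Adj u v) : cyclomaticNumber H ≤ cyclomaticNumber (H ⊔ edge u v) := by
  have h1 := card_edgeSet_sup_edge huv hn
  have h2 := card_connectedComponent_le_sup_edge_add_one H u v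
  simp only [cyclomaticNumber]
  omega

theorem cyclomaticNumber_add_one_le_sup_edge {H : SimpleGraph V} {u v : V} (huv : u ≠ v)
    (hn : ¬ H.Adj u v) (hr : H.Reachable u v) :
    cyclomaticNumber H + 1 ≤ cyclomaticNumber (H ⊔ edge u v) := by
  have h1 := card_edgeSet_sup_edge huv hn
  have h2 := card_connectedComponent_le_sup_edge_of_reachable hr
  simp only [cyclomaticNumber]
  omega

theorem cyclomaticNumber_mono {H K : SimpleGraph V} (h : H ≤ K) :
    cyclomaticNumber H ≤ cyclomaticNumber K := by
  induction hn : (K.edgeSet \ H.edgeSet).ncard using Nat.strong_induction_on generalizing H with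
  | _ n ih =>
    by_cases hKH : K ≤ H
    · rw [le_antisymm h hKH]
    · obtain ⟨u, v, huv, hne⟩ : ∃ u v, K.Adj u v ∧ ¬ H.Adj u v := by
        by_contra hcon
        push Not at hcon
        exact hKH fun a b hab => hcon a b hab
      refine (cyclomaticNumber_le_sup_edge huv.ne hne).trans
        (ih _ ?_ (sup_edge_le h huv) rfl)
      rw [← hn]
      refine Set.ncard_lt_ncard ⟨?_, ?_⟩ (Set.toFinite _)
      · exact Set.sdiff_subset_sdiff_right (edgeSet_mono le_sup_left)
      · intro hsub
        have := hsub (show s(u, v) ∈ K.edgeSet \ H.edgeSet from ⟨huv, hne⟩)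
        exact this.2 (Or.inr ((edge_adj u v u v).2 ⟨Or.inl ⟨rfl, rfl⟩, huv.ne⟩))

theorem cyclomaticNumber_nonneg (H : SimpleGraph V) : 0 ≤ cyclomaticNumber H := by
  refine le_trans ?_ (cyclomaticNumber_mono (bot_le : ⊥ ≤ H))
  have : Nat.card V ≤ Nat.card (⊥ : SimpleGraph V).ConnectedComponent := by
    refine Nat.card_le_card_of_injective (connectedComponentMk ⊥) fun a b h => ?_
    rw [ConnectedComponent.eq] at h
    simpa using h
  simp only [cyclomaticNumber]
  omega

theorem cyclomaticNumber_isolate_add_one_le {H : SimpleGraph V} {v a b : V} (ha : H.Adj v a)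
    (hb : H.Adj v b) (hab : a ≠ b) (hr : (isolate {v} H).Reachable a b) :
    cyclomaticNumber (isolate {v} H) + 1 ≤ cyclomaticNumber H := by
  have h1 : cyclomaticNumber (isolate {v} H) ≤ cyclomaticNumber (isolate {v} H ⊔ edge v a) :=
    cyclomaticNumber_mono le_sup_left
  have hle := sup_edge_le (isolate_le {v} H) ha
  have h2 : ¬ (isolate {v} H ⊔ edge v a).Adj v b := by
    rw [sup_adj, isolate_adj, edge_adj]
    simp [hab.symm, ha.ne]
  have h3 : (isolate {v} H ⊔ edge v a).Reachable v b := by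
    refine Reachable.trans (Adj.reachable (Or.inr ?_)) (hr.mono le_sup_left)
    rw [edge_adj]
    exact ⟨Or.inl ⟨rfl, rfl⟩, ha.ne⟩
  have h4 := cyclomaticNumber_add_one_le_sup_edge hb.ne h2 h3
  have h5 := cyclomaticNumber_mono (sup_edge_le hle hb)
  omega

/-- The edges va and vb close a first cycle through v. Once vc is present, y is joined to v through
c, so vy closes a second. The vertex c may coincide with a or b, so for vc only monotonicity is
used. -/
theorem cyclomaticNumber_isolate_add_two_le {H : SimpleGraph V} {v a b y c : V} (ha : H.Adj v a)
    (hb : H.Adj v b) (hab : a ≠ b) (hr : (isolate {v} H).Reachable a b) (hy : H.Adj v y)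
    (hc : H.Adj v c) (hyc : y ≠ c) (hr' : (isolate {v} H).Reachable y c) (hya : y ≠ a)
    (hyb : y ≠ b) : cyclomaticNumber (isolate {v} H) + 2 ≤ cyclomaticNumber H := by
  set D := isolate {v} H with hD
  set K := (D ⊔ edge v a) ⊔ edge v b with hK
  have hDK : D ≤ K := le_sup_left.trans le_sup_left
  have hKH : K ≤ H := sup_edge_le (sup_edge_le (isolate_le {v} H) ha) hb
  have hva : K.Adj v a := Or.inl (Or.inr ((edge_adj v a v a).2 ⟨Or.inl ⟨rfl, rfl⟩, ha.ne⟩))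
  have hvb : K.Adj v b := Or.inr ((edge_adj v b v b).2 ⟨Or.inl ⟨rfl, rfl⟩, hb.ne⟩)
  have hiso : isolate {v} K = D := by
    refine le_antisymm (isolate_mono _ hKH) fun p q hpq => ⟨hDK hpq, hpq.2⟩
  have h1 : cyclomaticNumber D + 1 ≤ cyclomaticNumber K := by
    have := cyclomaticNumber_isolate_add_one_le hva hvb hab (by rwa [hiso])
    rwa [hiso] at this
  have hKc : cyclomaticNumber K ≤ cyclomaticNumber (K ⊔ edge v c) :=
    cyclomaticNumber_mono le_sup_left
  have hny : ¬ (K ⊔ edge v c).Adj v y := by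
    rw [hK, sup_adj, sup_adj, sup_adj, hD, isolate_adj, edge_adj, edge_adj, edge_adj]
    simp [hya, hyb, hyc, ha.ne, hb.ne, hc.ne]
  have hry : (K ⊔ edge v c).Reachable v y := by
    refine Reachable.trans (Adj.reachable (Or.inr ?_)) (hr'.symm.mono (hDK.trans le_sup_left))
    rw [edge_adj]
    exact ⟨Or.inl ⟨rfl, rfl⟩, hc.ne⟩
  have h4 := cyclomaticNumber_add_one_le_sup_edge hy.ne hny hry
  have h5 := cyclomaticNumber_mono (sup_edge_le (sup_edge_le hKH hc) hy)
  omega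

/-- Remove an edge uv and induct. If u and v stay connected, a path closes up with uv to a cycle and
the old potential already fits uv; otherwise it can be rescaled on the component of u. With values
in `Circle` this switches gains on forests; with values in `ℤˣ` it two-colours graphs without odd
cycles. -/
theorem exists_potential {A : Type*} [CommGroup A] (W : V → V → A)
    (hW : ∀ i j, W j i = (W i j)⁻¹) (H : SimpleGraph V)
    (h : ∀ (v : V) (c : H.Walk v v), c.IsCycle →
      (c.darts.map fun d => W d.fst d.snd).prod = 1) :
    ∃ d : V → A, ∀ i j, H.Adj i j → W i j = d i * (d j)⁻¹ := by
  classical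
  induction hn : H.edgeSet.ncard using Nat.strong_induction_on generalizing H with
  | _ n ih =>
    by_cases hE : ∃ u v, H.Adj u v
    swap
    · push Not at hE
      exact ⟨fun _ => 1, fun i j hij => absurd hij (hE i j)⟩
    obtain ⟨u, v, huv⟩ := hE
    set K := H.deleteEdges {s(u, v)} with hK
    have hKH : K ≤ H := deleteEdges_le _
    have hedge : ∀ i j, H.Adj i j → K.Adj i j ∨ s(i, j) = s(u, v) := by
      intro i j hij
      by_cases hs : s(i, j) = s(u, v)
      · exact Or.inr hs
      · exact Or.inl (by rw [hK, deleteEdges_adj]; exact ⟨hij, hs⟩)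
    have hgain : ∀ {x y : V} (p : K.Walk x y), ((p.mapLe hKH).darts.map
        fun d => W d.fst d.snd).prod = (p.darts.map fun d => W d.fst d.snd).prod := by
      intro x y p
      rw [Walk.mapLe, Walk.darts_map, List.map_map]
      rfl
    obtain ⟨d, hd⟩ := ih K.edgeSet.ncard (by
      rw [← hn]
      refine Set.ncard_lt_ncard ⟨edgeSet_mono hKH, fun hsub => ?_⟩ (Set.toFinite _)
      have : s(u, v) ∈ K.edgeSet := hsub huv
      simp [hK] at this) K (fun x c hc => by
        rw [← hgain]
        exact h x _ (hc.mapLe hKH)) rfl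
    have htel : ∀ {x y : V} (p : K.Walk x y),
        (p.darts.map fun d => W d.fst d.snd).prod = d x * (d y)⁻¹ := by
      intro x y p
      induction p with
      | nil => simp
      | cons hab p ih => simp [ih, hd _ _ hab, mul_assoc]
    by_cases hr : K.Reachable u v
    · refine ⟨d, ?_⟩
      have huv' : W u v = d u * (d v)⁻¹ := by
        obtain ⟨p, hp⟩ := hr.symm.exists_isPath
        have hc := h u (Walk.cons huv (p.mapLe hKH)) (by
          rw [Walk.cons_isCycle_iff]
          refine ⟨hp.mapLe hKH, fun hmem => ?_⟩
          rw [Walk.edges_mapLe_eq_edges] at hmem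
          have := p.edges_subset_edgeSet hmem
          simp [hK] at this)
        rw [Walk.darts_cons, List.map_cons, List.prod_cons, hgain, htel] at hc
        rw [eq_inv_of_mul_eq_one_left hc]
        group
      intro i j hij
      rcases hedge i j hij with h' | h'
      · exact hd i j h'
      · rw [Sym2.eq_iff] at h'
        rcases h' with ⟨rfl, rfl⟩ | ⟨rfl, rfl⟩
        · exact huv'
        · rw [hW, huv']; group
    · refine ⟨fun i => if K.Reachable u i then d i * (W u v * d v * (d u)⁻¹) else d i, ?_⟩
      have huv' : W u v = d u * (W u v * d v * (d u)⁻¹) * (d v)⁻¹ := by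
        rw [mul_comm (W u v) (d v), mul_assoc (d v), mul_comm (d u), mul_assoc (d v),
          mul_assoc (W u v), inv_mul_cancel, mul_one, mul_comm (d v), mul_inv_cancel_right]
      intro i j hij
      rcases hedge i j hij with h' | h'
      · have hiff : K.Reachable u i ↔ K.Reachable u j :=
          ⟨fun hi => hi.trans h'.reachable, fun hj => hj.trans h'.reachable.symm⟩
        simp only [← hiff]
        split_ifs
        · rw [hd i j h', mul_inv, mul_mul_mul_comm, mul_inv_cancel, mul_one]
        · exact hd i j h'
      · rw [Sym2.eq_iff] at h'
        rcases h' with ⟨rfl, rfl⟩ | ⟨rfl, rfl⟩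
        · beta_reduce
          rw [if_pos (Reachable.refl _), if_neg hr]
          exact huv'
        · beta_reduce
          rw [if_neg hr, if_pos (Reachable.refl _), hW]
          nth_rewrite 1 [huv']
          group

end GraphTheory

/-! ### The upper bound for the rank of a gain graph, and the structure forced by equality. -/

section GainRank

open SimpleGraph Matrix

variable {V : Type*}

/-- The matrix of the graph `H` weighted by `W`. -/
noncomputable def gainMatrix (W : V → V → Circle) (H : SimpleGraph V) : Matrix V V ℂ :=
  open Classical in
  of fun i j => if H.Adj i j then (W i j : ℂ) else 0

/-- Reversing an ordered pair inverts its weight. -/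
def IsSkew (W : V → V → Circle) : Prop := ∀ i j, W j i = (W i j)⁻¹

theorem isSkew_one : IsSkew (1 : V → V → Circle) := fun _ _ => by simp

theorem gainMatrix_of_adj (W : V → V → Circle) {H : SimpleGraph V} {i j : V} (h : H.Adj i j) :
    gainMatrix W H i j = W i j := by
  simp [gainMatrix, h]

theorem gainMatrix_of_not_adj (W : V → V → Circle) {H : SimpleGraph V} {i j : V}
    (h : ¬ H.Adj i j) : gainMatrix W H i j = 0 := by
  simp [gainMatrix, h]

theorem gainMatrix_isHermitian {W : V → V → Circle} (hW : IsSkew W) (H : SimpleGraph V) :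
    (gainMatrix W H).IsHermitian := by
  ext i j
  rw [conjTranspose_apply]
  by_cases h : H.Adj i j
  · rw [gainMatrix_of_adj W h, gainMatrix_of_adj W h.symm, hW i j, Circle.coe_inv_eq_conj]
    simp
  · rw [gainMatrix_of_not_adj W h, gainMatrix_of_not_adj W (fun h' => h h'.symm), star_zero]

theorem gainMatrix_one_isSymm (H : SimpleGraph V) : (gainMatrix 1 H).IsSymm := by
  ext i j
  rw [transpose_apply]
  by_cases h : H.Adj i j
  · rw [gainMatrix_of_adj 1 h, gainMatrix_of_adj 1 h.symm]
    rfl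
  · rw [gainMatrix_of_not_adj 1 h, gainMatrix_of_not_adj 1 (fun h' => h h'.symm)]

theorem zeroCross_gainMatrix [DecidableEq V] (W : V → V → Circle) (H : SimpleGraph V) (w : V) :
    zeroCross (gainMatrix W H) w = gainMatrix W (isolate {w} H) := by
  ext i j
  rw [zeroCross, of_apply]
  split_ifs with hij
  · rw [gainMatrix_of_not_adj]
    rintro ⟨-, h1, h2⟩
    exact hij.elim h1 h2
  · push Not at hij
    by_cases h : H.Adj i j
    · rw [gainMatrix_of_adj W h, gainMatrix_of_adj W (isolate_adj.2 ⟨h, hij.1, hij.2⟩)]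
    · rw [gainMatrix_of_not_adj W h, gainMatrix_of_not_adj W (mt (fun h' => (isolate_adj.1 h').1) h)]

variable [Fintype V]

theorem gainMatrix_mulVec (W : V → V → Circle) (H : SimpleGraph V) (z : V → ℂ) (i : V) :
    open Classical in
    (gainMatrix W H *ᵥ z) i = ∑ j, if H.Adj i j then (W i j : ℂ) * z j else 0 := by
  classical
  simp only [mulVec, dotProduct, gainMatrix, of_apply, ite_mul, zero_mul]

/-- The rank of the graph `H` weighted by `W`. -/
noncomputable def gainRank (W : V → V → Circle) (H : SimpleGraph V) : ℕ :=
  (gainMatrix W H).rank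

section

variable {W : V → V → Circle} (hW : IsSkew W) (H : SimpleGraph V) (w : V)
include hW

theorem gainRank_isolate_le : gainRank W (isolate {w} H) ≤ gainRank W H := by
  classical
  rw [gainRank, ← zeroCross_gainMatrix]
  exact rank_zeroCross_le (gainMatrix_isHermitian hW H) w

theorem gainRank_le_isolate_add_two : gainRank W H ≤ gainRank W (isolate {w} H) + 2 := by
  classical
  rw [gainRank, gainRank, ← zeroCross_gainMatrix]
  exact rank_le_rank_zeroCross_add_two (gainMatrix_isHermitian hW H) w

theorem gainRank_eq_isolate_iff :
    gainRank W H = gainRank W (isolate {w} H) ↔ ∃ z, gainMatrix W H *ᵥ z = 0 ∧ z w ≠ 0 := by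
  classical
  rw [gainRank, gainRank, ← zeroCross_gainMatrix]
  exact rank_eq_rank_zeroCross_iff (gainMatrix_isHermitian hW H) w

theorem gainRank_eq_isolate_add_two_iff [DecidableEq V] :
    gainRank W H = gainRank W (isolate {w} H) + 2 ↔
      ∃ k, k w = 0 ∧ gainMatrix W H *ᵥ k = Pi.single w 1 := by
  rw [gainRank, gainRank, ← zeroCross_gainMatrix]
  exact rank_eq_rank_zeroCross_add_two_iff (gainMatrix_isHermitian hW H) w

end

theorem gainMatrix_isolate_mulVec [DecidableEq V] (W : V → V → Circle) (H : SimpleGraph V)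
    {w : V} {z : V → ℂ} (hz : z w = 0) (i : V) :
    (gainMatrix W (isolate {w} H) *ᵥ z) i = if i = w then 0 else (gainMatrix W H *ᵥ z) i := by
  rw [← zeroCross_gainMatrix, zeroCross_mulVec_of_eq_zero _ hz]

/-- On a forest the gains come from a potential, so A(Φ) is A(G) multiplied by diagonal matrices. -/
theorem gainRank_le_of_isAcyclic {W : V → V → Circle} (hW : IsSkew W) {H : SimpleGraph V}
    (hH : H.IsAcyclic) : gainRank W H ≤ gainRank 1 H := by
  classical
  obtain ⟨d, hd⟩ := exists_potential W hW H fun v c hc => absurd hc (hH c)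
  have : gainMatrix W H = diagonal (fun i => (d i : ℂ)) * gainMatrix 1 H *
      diagonal (fun i => ((d i)⁻¹ : ℂ)) := by
    ext i j
    rw [mul_diagonal, diagonal_mul]
    simp only [gainMatrix, of_apply]
    split_ifs with h
    · rw [hd i j h]; simp
    · simp
  rw [gainRank, this]
  exact (rank_mul_le_left _ _).trans (rank_mul_le_right _ _)

section Cyclic

variable {n : ℕ} {f : ZMod n → V} {H : SimpleGraph V}

omit [Fintype V] in
theorem IsCyclicEmbedding.reachable (hf : IsCyclicEmbedding H f) (i : ZMod n) :
    (isolate {f i} H).Reachable (f (i + 1)) (f (i - 1)) := by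
  have h3 := hf.three_le
  have hne : ∀ k : ℕ, 1 ≤ k → k < n → f (i + k) ≠ f i := by
    intro k hk hkn h
    have : (k : ZMod n) = 0 := by simpa using hf.injective h
    rw [ZMod.natCast_eq_zero_iff] at this
    exact absurd (Nat.le_of_dvd hk this) (by omega)
  have key : ∀ k : ℕ, 1 ≤ k → k < n → (isolate {f i} H).Reachable (f (i + 1)) (f (i + k)) := by
    intro k hk
    induction k, hk using Nat.le_induction with
    | base => intro _; simp
    | succ k hk ih =>
      intro hkn
      refine (ih (by omega)).trans (Adj.reachable ⟨?_, hne k hk (by omega), ?_⟩)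
      · simpa [add_assoc] using hf.adj (i + k)
      · exact hne (k + 1) (by omega) hkn
  have := key (n - 1) (by omega) (by omega)
  rwa [Nat.cast_sub (by omega), ZMod.natCast_self, Nat.cast_one, zero_sub, ← sub_eq_add_neg] at this

omit [Fintype V] in
theorem IsCyclicEmbedding.adj_sub_one (hf : IsCyclicEmbedding H f) (i : ZMod n) :
    H.Adj (f i) (f (i - 1)) := by
  have := hf.adj (i - 1)
  rw [sub_add_cancel] at this
  exact this.symm

omit [Fintype V] in
theorem IsCyclicEmbedding.add_one_ne_sub_one (hf : IsCyclicEmbedding H f) (i : ZMod n) :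
    f (i + 1) ≠ f (i - 1) := by
  intro h
  have h2 := hf.injective h
  have h3 := hf.three_le
  have : ((2 : ℕ) : ZMod n) = 0 := by
    push_cast
    linear_combination h2
  rw [ZMod.natCast_eq_zero_iff] at this
  exact absurd (Nat.le_of_dvd (by omega) this) (by omega)

omit [Fintype V] in
theorem IsCyclicEmbedding.mono {K : SimpleGraph V} (hf : IsCyclicEmbedding H f)
    (h : ∀ i, K.Adj (f i) (f (i + 1))) : IsCyclicEmbedding K f :=
  ⟨hf.three_le, hf.injective, h⟩

omit [Fintype V] in
theorem IsCyclicEmbedding.isolate {s : Set V} (hf : IsCyclicEmbedding H f)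
    (h : ∀ i, f i ∉ s) : IsCyclicEmbedding (isolate s H) f :=
  hf.mono fun i => ⟨hf.adj i, h i, h _⟩

theorem IsCyclicEmbedding.cyclomaticNumber_isolate_add_one_le (hf : IsCyclicEmbedding H f)
    (i : ZMod n) : cyclomaticNumber (UnitGain.isolate {f i} H) + 1 ≤ cyclomaticNumber H :=
  UnitGain.cyclomaticNumber_isolate_add_one_le (hf.adj i) (hf.adj_sub_one i)
    (hf.add_one_ne_sub_one i) (hf.reachable i)

end Cyclic

omit [Fintype V] in
theorem isolate_singleton_lt {H : SimpleGraph V} {v a : V} (h : H.Adj v a) :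
    isolate {v} H < H :=
  lt_of_le_of_ne (isolate_le _ _) fun he =>
    absurd rfl (he.ge h : (isolate {v} H).Adj v a).2.1

theorem gainRank_le_add_two_mul_cyclomaticNumber {W : V → V → Circle} (hW : IsSkew W)
    (H : SimpleGraph V) : (gainRank W H : ℤ) ≤ gainRank 1 H + 2 * cyclomaticNumber H := by
  induction H using WellFoundedLT.induction with
  | _ H ih =>
    by_cases hH : H.IsAcyclic
    · have h1 := gainRank_le_of_isAcyclic hW hH
      have h2 := cyclomaticNumber_nonneg H
      omega
    · simp only [IsAcyclic, not_forall, not_not] at hH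
      obtain ⟨v, c, hc⟩ := hH
      obtain ⟨f, hf, -⟩ := exists_isCyclicEmbedding c hc
      have h1 := ih _ (isolate_singleton_lt (hf.adj 0))
      have h2 := hf.cyclomaticNumber_isolate_add_one_le 0
      have h3 := gainRank_le_isolate_add_two hW H (f 0)
      have h4 := gainRank_isolate_le isSkew_one H (f 0)
      omega

/-- The rank of the weighted graph attains its upper bound. -/
def UpperOptimal (W : V → V → Circle) (H : SimpleGraph V) : Prop :=
  (gainRank W H : ℤ) = gainRank 1 H + 2 * cyclomaticNumber H

variable {W : V → V → Circle} {H : SimpleGraph V}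

theorem upperOptimal_of_le (hW : IsSkew W)
    (h : (gainRank 1 H : ℤ) + 2 * cyclomaticNumber H ≤ gainRank W H) : UpperOptimal W H :=
  le_antisymm (gainRank_le_add_two_mul_cyclomaticNumber hW H) h

/-- The inequalities for `H` minus a cycle vertex add up to the upper bound for `H`, so equality
there forces equality in each. -/
theorem UpperOptimal.isolate_of_isCyclicEmbedding (hH : UpperOptimal W H) (hW : IsSkew W) {n : ℕ}
    {f : ZMod n → V} (hf : IsCyclicEmbedding H f) (i : ZMod n) :
    UpperOptimal W (isolate {f i} H) ∧ gainRank 1 H = gainRank 1 (isolate {f i} H) ∧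
      gainRank W H = gainRank W (isolate {f i} H) + 2 ∧
      cyclomaticNumber H = cyclomaticNumber (isolate {f i} H) + 1 := by
  have h1 := gainRank_le_add_two_mul_cyclomaticNumber hW (isolate {f i} H)
  have h2 := hf.cyclomaticNumber_isolate_add_one_le i
  have h3 := gainRank_le_isolate_add_two hW H (f i)
  have h4 := gainRank_isolate_le isSkew_one H (f i)
  unfold UpperOptimal at hH ⊢
  omega

theorem UpperOptimal.not_reachable (hH : UpperOptimal W H) (hW : IsSkew W) {n : ℕ}
    {f : ZMod n → V} (hf : IsCyclicEmbedding H f) (i : ZMod n) {y c : V} (hy : H.Adj (f i) y)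
    (hc : H.Adj (f i) c) (hyc : y ≠ c) (h1 : y ≠ f (i + 1)) (h2 : y ≠ f (i - 1)) :
    ¬ (isolate {f i} H).Reachable y c := by
  intro hr
  have h3 := cyclomaticNumber_isolate_add_two_le (hf.adj i) (hf.adj_sub_one i)
    (hf.add_one_ne_sub_one i) (hf.reachable i) hy hc hyc hr h1 h2
  have h4 := (hH.isolate_of_isCyclicEmbedding hW hf i).2.2.2
  omega

/-- Otherwise the rest of f joins f (i + 1) to f (i - 1) away from the common vertex, and together
with g this makes θ drop by 2 there. -/
theorem UpperOptimal.add_one_mem_of_eq (hH : UpperOptimal W H) (hW : IsSkew W) {n m : ℕ}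
    {f : ZMod n → V} {g : ZMod m → V} (hf : IsCyclicEmbedding H f) (hg : IsCyclicEmbedding H g)
    {i : ZMod n} {j : ZMod m} (hij : f i = g j) :
    f (i + 1) = g (j + 1) ∨ f (i + 1) = g (j - 1) := by
  by_contra hcon
  push Not at hcon
  refine hH.not_reachable hW hg j (y := f (i + 1)) (c := f (i - 1)) (hij ▸ hf.adj i)
    (hij ▸ hf.adj_sub_one i) (hf.add_one_ne_sub_one i) hcon.1 hcon.2 ?_
  rw [← hij]
  exact hf.reachable i

theorem UpperOptimal.range_subset_of_eq (hH : UpperOptimal W H) (hW : IsSkew W) {n m : ℕ}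
    {f : ZMod n → V} {g : ZMod m → V} (hf : IsCyclicEmbedding H f) (hg : IsCyclicEmbedding H g)
    {i : ZMod n} {j : ZMod m} (hij : f i = g j) (k : ZMod n) : ∃ l, f k = g l := by
  have h3 := hf.three_le
  have : NeZero n := ⟨by omega⟩
  have key : ∀ a : ℕ, ∃ l, f (i + a) = g l := by
    intro a
    induction a with
    | zero => exact ⟨j, by simpa using hij⟩
    | succ a ih =>
      obtain ⟨l, hl⟩ := ih
      push_cast
      rw [← add_assoc]
      rcases hH.add_one_mem_of_eq hW hf hg hl with h | h
      exacts [⟨_, h⟩, ⟨_, h⟩]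
  obtain ⟨l, hl⟩ := key (k - i).val
  exact ⟨l, by simpa using hl⟩

theorem UpperOptimal.edge_eq_of_eq (hH : UpperOptimal W H) (hW : IsSkew W) {n m : ℕ}
    {f : ZMod n → V} {g : ZMod m → V} (hf : IsCyclicEmbedding H f) (hg : IsCyclicEmbedding H g)
    {i : ZMod n} {j : ZMod m} (hij : f i = g j) (k : ZMod n) :
    ∃ l, s(f k, f (k + 1)) = s(g l, g (l + 1)) := by
  obtain ⟨l, hl⟩ := hH.range_subset_of_eq hW hf hg hij k
  rcases hH.add_one_mem_of_eq hW hf hg hl with h | h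
  · exact ⟨l, by rw [hl, h]⟩
  · exact ⟨l - 1, by rw [hl, h, sub_add_cancel, Sym2.eq_swap]⟩

end GainRank

/-! ### Neighbours of a cycle: deleting such a vertex or its edge to the cycle. -/

section Boundary

open SimpleGraph Matrix

variable {V : Type*}

/-- Every edge of `H` joins two vertices of opposite sign. -/
def IsSigning (H : SimpleGraph V) (s : V → ℂ) : Prop :=
  (∀ i, s i ≠ 0) ∧ ∀ i j, H.Adj i j → s j = -s i

theorem IsSigning.mono {H K : SimpleGraph V} {s : V → ℂ} (hs : IsSigning H s) (h : K ≤ H) :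
    IsSigning K s :=
  ⟨hs.1, fun i j hij => hs.2 i j (h hij)⟩

theorem exists_isSigning [Finite V] (H : SimpleGraph V)
    (h : ∀ (v : V) (c : H.Walk v v), c.IsCycle → Even c.length) : ∃ s, IsSigning H s := by
  obtain ⟨d, hd⟩ := exists_potential (fun _ _ : V => (-1 : ℤˣ)) (fun _ _ => by simp) H
    fun v c hc => by
      rw [List.map_const', List.prod_replicate, Walk.length_darts]
      exact (h v c hc).neg_one_pow
  refine ⟨fun i => ((d i : ℤ) : ℂ), fun i => by simp, fun i j hij => ?_⟩
  have := hd i j hij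
  have h2 : d j = -d i := by
    rw [eq_mul_inv_iff_mul_eq] at this
    rw [← this]
    simp
  simp [h2]

theorem not_reachable_isolate {H : SimpleGraph V} {w y : V} (h : y ≠ w) :
    ¬ (isolate {w} H).Reachable y w := by
  rintro ⟨p⟩
  cases hp : p.reverse with
  | nil => exact h rfl
  | cons hadj _ => exact hadj.2.1 rfl

variable [Fintype V] [DecidableEq V]

section Kernel

variable {H : SimpleGraph V} {w y : V} {z : V → ℂ}

-- By `hS`, wy is the only edge between w and the component of y, so truncating −z to that component
-- disturbs the kernel equations only at y, where the term z w is lost, and at w, where only −z y is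
-- seen.
open Classical in
theorem mulVec_neg_indicator_reachable (hwy : H.Adj w y) (hz : gainMatrix 1 H *ᵥ z = 0)
    (hS : ∀ c, H.Adj w c → (isolate {w} H).Reachable y c → c = y) :
    gainMatrix 1 H *ᵥ (fun j => if (isolate {w} H).Reachable y j then -z j else 0) =
      Pi.single y (z w) - Pi.single w (z y) := by
  have hw : ¬ (isolate {w} H).Reachable y w := not_reachable_isolate hwy.ne'
  ext i
  have hzi := congrFun hz i
  rw [gainMatrix_mulVec] at hzi ⊢
  simp only [Pi.one_apply, Circle.coe_one, one_mul, Pi.zero_apply] at hzi ⊢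
  by_cases hi : (isolate {w} H).Reachable y i
  · have hiw : i ≠ w := by rintro rfl; exact hw hi
    have hterm : ∀ j, (if H.Adj i j then if (isolate {w} H).Reachable y j then -z j else 0 else 0)
        = -(if H.Adj i j then z j else 0) + if j = w then (if H.Adj i w then z w else 0) else 0 := by
      intro j
      by_cases hij : H.Adj i j
      · by_cases hj : j = w
        · subst hj
          simp [hij, hw]
        · have : (isolate {w} H).Reachable y j :=
            hi.trans (Adj.reachable ⟨hij, hiw, hj⟩)
          simp [hij, hj, this]
      · by_cases hj : j = w
        · subst hj; simp [hij]
        · simp [hij, hj]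
    rw [Finset.sum_congr rfl fun j _ => hterm j, Finset.sum_add_distrib, Finset.sum_neg_distrib,
      hzi, Finset.sum_ite_eq' Finset.univ w, if_pos (Finset.mem_univ _)]
    by_cases hiy : i = y
    · subst hiy
      simp [hwy.symm, hiw]
    · have : ¬ H.Adj i w := fun h => hiy (hS i h.symm hi)
      simp [this, hiy, hiw]
  · have hiy : i ≠ y := by rintro rfl; exact hi (Reachable.refl _)
    by_cases hiw : i = w
    · subst hiw
      have hterm : ∀ j, (if H.Adj i j then if (isolate {i} H).Reachable y j then -z j else 0
          else 0) = if j = y then -z y else 0 := by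
        intro j
        by_cases hj : j = y
        · subst hj
          simp [hwy]
        · rw [if_neg hj]
          split_ifs with h1 h2
          · exact absurd (hS j h1 h2) hj
          · rfl
          · rfl
      rw [Finset.sum_congr rfl fun j _ => hterm j, Finset.sum_ite_eq' Finset.univ y,
        if_pos (Finset.mem_univ _)]
      simp [hiy]
    · rw [Finset.sum_eq_zero]
      · simp [hiy, hiw]
      · intro j _
        split_ifs with h1 h2
        · by_cases hj : j = w
          · subst hj; exact absurd h2 hw
          · exact absurd (h2.trans (Adj.reachable ⟨h1.symm, hj, hiw⟩)) hi
        · rfl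
        · rfl

/-- Let q be the truncated −z and D the matrix of H−w, so that D q = e_y. Multiplication by the
signing s anticommutes with D, hence D(sq) = −(s y) e_y. Pairing with q and using that D is
symmetric gives −(s y)(q y) = (s y)(q y), so q y = 0. -/
theorem exists_kernel_certificate (hwy : H.Adj w y) (hz : gainMatrix 1 H *ᵥ z = 0) (hzw : z w = 1)
    (hS : ∀ c, H.Adj w c → (isolate {w} H).Reachable y c → c = y)
    {s : V → ℂ} (hs : IsSigning (isolate {w} H) s) :
    z y = 0 ∧ ∃ q : V → ℂ, q y = 0 ∧ gainMatrix 1 H *ᵥ q = Pi.single y 1 ∧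
      gainMatrix 1 (isolate {w} H) *ᵥ q = Pi.single y 1 := by
  classical
  have hAq := mulVec_neg_indicator_reachable hwy hz hS
  set q : V → ℂ := fun j => if (isolate {w} H).Reachable y j then -z j else 0 with hq
  have hqw : q w = 0 := if_neg (not_reachable_isolate hwy.ne')
  have hqy : q y = -z y := if_pos (Reachable.refl _)
  have hDq : gainMatrix 1 (isolate {w} H) *ᵥ q = Pi.single y 1 := by
    ext i
    rw [gainMatrix_isolate_mulVec 1 H hqw, hAq, hzw]
    by_cases hi : i = w
    · subst hi
      simp [hwy.ne]
    · simp [hi]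
  have hDs : gainMatrix 1 (isolate {w} H) *ᵥ (fun j => s j * q j) = Pi.single y (-s y) := by
    ext i
    have h1 : (gainMatrix 1 (isolate {w} H) *ᵥ (fun j => s j * q j)) i =
        -s i * (gainMatrix 1 (isolate {w} H) *ᵥ q) i := by
      rw [gainMatrix_mulVec, gainMatrix_mulVec, Finset.mul_sum]
      refine Finset.sum_congr rfl fun j _ => ?_
      split_ifs with hij
      · rw [hs.2 i j hij]
        ring
      · simp
    rw [h1, hDq]
    by_cases hi : i = y
    · subst hi; simp
    · simp [hi]
  have hsymm : q ⬝ᵥ (gainMatrix 1 (isolate {w} H) *ᵥ (fun j => s j * q j)) =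
      (gainMatrix 1 (isolate {w} H) *ᵥ q) ⬝ᵥ (fun j => s j * q j) := by
    rw [dotProduct_mulVec, ← mulVec_transpose, (gainMatrix_one_isSymm _).eq]
  rw [hDs, hDq] at hsymm
  simp only [dotProduct_single, single_dotProduct, one_mul] at hsymm
  have hzy : z y = 0 := by
    have h2 : (2 : ℂ) * (s y * q y) = 0 := by linear_combination -hsymm
    have h3 : q y = 0 := by simpa [hs.1 y] using h2
    rw [hqy] at h3
    simpa using h3
  refine ⟨hzy, q, by rw [hqy, hzy, neg_zero], ?_, hDq⟩
  rw [hAq, hzw, hzy]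
  simp

-- Without the edge wy the component of y is cut off from w. Setting z to zero there leaves the
-- equation at w intact because z y = 0.
open Classical in
theorem deleteEdges_mulVec_indicator_not_reachable (hwy : H.Adj w y)
    (hz : gainMatrix 1 H *ᵥ z = 0) (hzy : z y = 0)
    (hS : ∀ c, H.Adj w c → (isolate {w} H).Reachable y c → c = y) :
    gainMatrix 1 (H.deleteEdges {s(w, y)}) *ᵥ
      (fun j => if (isolate {w} H).Reachable y j then 0 else z j) = 0 := by
  have hw : ¬ (isolate {w} H).Reachable y w := not_reachable_isolate hwy.ne'
  ext i
  have hzi := congrFun hz i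
  rw [gainMatrix_mulVec] at hzi ⊢
  simp only [Pi.one_apply, Circle.coe_one, one_mul, Pi.zero_apply] at hzi ⊢
  by_cases hi : (isolate {w} H).Reachable y i
  · have hiw : i ≠ w := by rintro rfl; exact hw hi
    refine Finset.sum_eq_zero fun j _ => ?_
    split_ifs with h1 h2
    · rfl
    · rw [deleteEdges_adj] at h1
      by_cases hj : j = w
      · subst hj
        have := hS i h1.1.symm hi
        subst this
        exact absurd (Sym2.eq_swap) h1.2
      · exact absurd (hi.trans (Adj.reachable ⟨h1.1, hiw, hj⟩)) h2
    · rfl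
  · refine Eq.trans (Finset.sum_congr rfl fun j _ => ?_) hzi
    by_cases hij : H.Adj i j
    · by_cases hj : (isolate {w} H).Reachable y j
      · have hjw : j ≠ w := by rintro rfl; exact hw hj
        have hiw : i = w := by
          by_contra hiw
          exact hi (hj.trans (Adj.reachable ⟨hij.symm, hjw, hiw⟩))
        subst hiw
        have := hS j hij hj
        subst this
        simp [hzy]
      · have hK : (H.deleteEdges {s(w, y)}).Adj i j := by
          rw [deleteEdges_adj]
          refine ⟨hij, fun h => ?_⟩
          rcases Sym2.eq_iff.1 h with ⟨-, rfl⟩ | ⟨rfl, -⟩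
          · exact hj (Reachable.refl _)
          · exact hi (Reachable.refl _)
        rw [if_pos hK, if_pos hij, if_neg hj]
    · rw [if_neg hij, if_neg fun h => hij (deleteEdges_le _ h)]

end Kernel

omit [Fintype V] [DecidableEq V] in
theorem isolate_deleteEdges {H : SimpleGraph V} {w y : V} {t : Set V} (hw : w ∈ t) :
    isolate t (H.deleteEdges {s(w, y)}) = isolate t H := by
  ext a b
  simp only [isolate_adj, deleteEdges_adj]
  constructor
  · rintro ⟨⟨h, -⟩, h'⟩
    exact ⟨h, h'⟩
  · rintro ⟨h, ha, hb⟩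
    refine ⟨⟨h, fun he => ?_⟩, ha, hb⟩
    rcases Sym2.eq_iff.1 he with ⟨rfl, -⟩ | ⟨-, rfl⟩
    · exact ha hw
    · exact hb hw

variable {W : V → V → Circle} {H : SimpleGraph V} {n : ℕ} {f : ZMod n → V}

theorem UpperOptimal.boundary (hH : UpperOptimal W H) (hW : IsSkew W)
    (hf : IsCyclicEmbedding H f) {i : ZMod n} {y : V} (hy : H.Adj (f i) y)
    (h1 : y ≠ f (i + 1)) (h2 : y ≠ f (i - 1)) {s : V → ℂ}
    (hs : IsSigning (isolate {f i} H) s) :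
    (gainRank 1 H = gainRank 1 (isolate {y} H) + 2 ∧ UpperOptimal W (isolate {y} H)) ∧
    (gainRank 1 (H.deleteEdges {s(f i, y)}) = gainRank 1 H ∧
      UpperOptimal W (H.deleteEdges {s(f i, y)})) := by
  obtain ⟨hDopt, hD1, hDW, -⟩ := hH.isolate_of_isCyclicEmbedding hW hf i
  have hS : ∀ c, H.Adj (f i) c → (isolate {f i} H).Reachable y c → c = y := by
    intro c hc hr
    by_contra hne
    exact hH.not_reachable hW hf i hy hc (Ne.symm hne) h1 h2 hr
  obtain ⟨z, hz, hzw⟩ : ∃ z, gainMatrix 1 H *ᵥ z = 0 ∧ z (f i) = 1 := by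
    obtain ⟨z, hz, hne⟩ := (gainRank_eq_isolate_iff isSkew_one H (f i)).1 hD1
    exact ⟨(z (f i))⁻¹ • z, by rw [mulVec_smul, hz, smul_zero], by simp [hne]⟩
  obtain ⟨hzy, q, hqy, hAq, hDq⟩ := exists_kernel_certificate hy hz hzw hS hs
  have hrank : gainRank 1 H = gainRank 1 (isolate {y} H) + 2 :=
    (gainRank_eq_isolate_add_two_iff isSkew_one H y).2 ⟨q, hqy, hAq⟩
  have hrankD : gainRank 1 (isolate {f i} H) = gainRank 1 (isolate {y} (isolate {f i} H)) + 2 :=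
    (gainRank_eq_isolate_add_two_iff isSkew_one _ y).2 ⟨q, hqy, hDq⟩
  refine ⟨⟨hrank, upperOptimal_of_le hW ?_⟩, ?_⟩
  · have h3 := gainRank_le_isolate_add_two hW H y
    have h4 := cyclomaticNumber_mono (isolate_le {y} H)
    unfold UpperOptimal at hH
    omega
  · set K := H.deleteEdges {s(f i, y)} with hK
    have hKH : K ≤ H := deleteEdges_le _
    have hisoK : isolate {f i} K = isolate {f i} H := isolate_deleteEdges rfl
    have hK1 : gainRank 1 K = gainRank 1 H := by
      classical
      rw [hD1, ← hisoK]
      refine (gainRank_eq_isolate_iff isSkew_one K (f i)).2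
        ⟨_, deleteEdges_mulVec_indicator_not_reachable hy hz hzy hS, ?_⟩
      rw [if_neg (not_reachable_isolate hy.ne'), hzw]
      exact one_ne_zero
    have hKW : gainRank W K = gainRank W H := by
      obtain ⟨k, hk0, hk⟩ := (gainRank_eq_isolate_add_two_iff hW H (f i)).1 hDW
      -- Otherwise k is a kernel vector of Φ − f i that is nonzero at y, so deleting y there keeps
      -- the gain rank. But it lowers the ordinary rank by 2, and the result would violate the upper
      -- bound.
      have hky : k y = 0 := by
        by_contra hne
        have h3 : gainMatrix W (isolate {f i} H) *ᵥ k = 0 := by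
          ext j
          rw [gainMatrix_isolate_mulVec W H hk0, hk]
          by_cases hj : j = f i <;> simp [hj]
        have h4 := (gainRank_eq_isolate_iff hW (isolate {f i} H) y).2 ⟨k, h3, hne⟩
        have h5 := gainRank_le_add_two_mul_cyclomaticNumber hW (isolate {y} (isolate {f i} H))
        have h6 := cyclomaticNumber_mono (isolate_le {y} (isolate {f i} H))
        unfold UpperOptimal at hDopt
        omega
      rw [hDW, ← hisoK]
      -- As k vanishes at both ends of the deleted edge, the product with k is unchanged.
      refine (gainRank_eq_isolate_add_two_iff hW K (f i)).2 ⟨k, hk0, ?_⟩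
      rw [← hk]
      ext a
      rw [gainMatrix_mulVec, gainMatrix_mulVec]
      refine Finset.sum_congr rfl fun b _ => ?_
      by_cases hab : H.Adj a b
      · by_cases he : s(a, b) = s(f i, y)
        · have : k b = 0 := by
            rcases Sym2.eq_iff.1 he with ⟨-, rfl⟩ | ⟨-, rfl⟩
            exacts [hky, hk0]
          simp [this]
        · have hKab : K.Adj a b := by
            rw [hK, deleteEdges_adj]
            exact ⟨hab, he⟩
          rw [if_pos hKab, if_pos hab]
      · rw [if_neg hab, if_neg fun h => hab (hKH h)]
    refine ⟨hK1, upperOptimal_of_le hW ?_⟩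
    have h4 := cyclomaticNumber_mono hKH
    unfold UpperOptimal at hH
    omega

end Boundary

/-! ### Explicit kernels on a cycle, and the removal of a whole cycle. -/

section CycleRank

open SimpleGraph Matrix Module

theorem apply_val_natCast_of_periodic {n : ℕ} {F : ℕ → ℂ} (hF : ∀ k, F (k + n) = F k) (k : ℕ) :
    F (k : ZMod n).val = F k := by
  rw [ZMod.val_natCast]
  exact Function.Periodic.map_mod_nat (f := F) hF k

theorem exists_natCast_add_one_eq {n : ℕ} [NeZero n] (i : ZMod n) :
    ∃ k : ℕ, ((k + 1 : ℕ) : ZMod n) = i :=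
  ⟨(i - 1).val, by simp⟩

theorem prod_zmod_eq_prod_range {A : Type*} [CommMonoid A] {n : ℕ} [NeZero n] (F : ZMod n → A) :
    ∏ i, F i = ∏ k ∈ Finset.range n, F (k : ZMod n) := by
  refine Finset.prod_nbij' (fun i => i.val) (fun k => (k : ZMod n)) ?_ ?_ ?_ ?_ ?_
  · intro i _
    simpa using i.val_lt
  · simp
  · simp
  · intro k hk
    exact ZMod.val_natCast_of_lt (by simpa using hk)
  · simp

/-- The vectors on a cycle of length `n` annihilated by its adjacency matrix. -/
def alternatingVectors (n : ℕ) : Submodule ℂ (ZMod n → ℂ) where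
  carrier := {z | ∀ i, z (i + 1) + z (i - 1) = 0}
  add_mem' {a b} ha hb i := by
    have h1 := ha i
    have h2 := hb i
    simp only [Pi.add_apply]
    linear_combination h1 + h2
  zero_mem' i := by simp
  smul_mem' c a ha i := by
    have h1 := ha i
    simp only [Pi.smul_apply, smul_eq_mul]
    linear_combination c * h1

theorem finrank_alternatingVectors {n : ℕ} [NeZero n] (hn : 4 ∣ n) :
    finrank ℂ (alternatingVectors n) = 2 := by
  set l : (ZMod n → ℂ) →ₗ[ℂ] ℂ × ℂ := (LinearMap.proj 0).prod (LinearMap.proj 1)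
  have h1 : alternatingVectors n ⊓ LinearMap.ker l = ⊥ := by
    rw [eq_bot_iff]
    rintro z ⟨hz, hl⟩
    have hl' : z 0 = 0 ∧ z 1 = 0 := by simpa [l] using hl
    have key : ∀ k : ℕ, z k = 0 ∧ z (k + 1 : ℕ) = 0 := by
      intro k
      induction k with
      | zero => simpa using hl'
      | succ k ih =>
        refine ⟨ih.2, ?_⟩
        have := hz (k + 1 : ℕ)
        push_cast at this ih ⊢
        rw [add_sub_cancel_right, ih.1, add_zero] at this
        exact this
    rw [Submodule.mem_bot]
    ext i
    simpa using (key i.val).1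
  have h2 : (alternatingVectors n).map l = ⊤ := by
    rw [eq_top_iff]
    rintro ⟨a, b⟩ -
    obtain ⟨m, rfl⟩ := hn
    -- Powers of ±i solve F (k + 2) = −F k and have period 4; the coefficients are chosen so that F
    -- 0 = a and F 1 = b.
    set F : ℕ → ℂ := fun k => (a - Complex.I * b) / 2 * Complex.I ^ k +
      (a + Complex.I * b) / 2 * (-Complex.I) ^ k with hF
    have hper : ∀ k, F (k + 4 * m) = F k := by
      intro k
      have h4 : (-Complex.I) ^ 4 = 1 := by rw [neg_pow, Complex.I_pow_four]; norm_num
      simp only [hF, pow_add, pow_mul, Complex.I_pow_four, h4, one_pow, mul_one]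
    have hval := apply_val_natCast_of_periodic hper
    refine ⟨fun i => F i.val, ?_, ?_⟩
    · intro i
      obtain ⟨k, rfl⟩ := exists_natCast_add_one_eq i
      have e1 : ((k + 1 : ℕ) : ZMod (4 * m)) + 1 = ((k + 2 : ℕ) : ZMod (4 * m)) := by
        push_cast; ring
      have e2 : ((k + 1 : ℕ) : ZMod (4 * m)) - 1 = ((k : ℕ) : ZMod (4 * m)) := by
        push_cast; ring
      simp only [e1, e2, hval]
      simp only [hF, pow_add, neg_sq, Complex.I_sq]
      ring
    · have e1 : F (1 : ZMod (4 * m)).val = F 1 := by simpa using hval 1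
      have : l (fun i => F i.val) = (F 0, F 1) := by simp [l, e1]
      rw [this]
      simp only [hF, pow_zero, pow_one, Prod.mk.injEq]
      refine ⟨by ring, ?_⟩
      linear_combination -b * Complex.I_sq
  rw [← finrank_inf_ker_add_finrank_map _ l, h1, h2]
  simp

variable {V : Type*} [Fintype V] {W : V → V → Circle} {H : SimpleGraph V}
  {n : ℕ} {f : ZMod n → V}

/-- No edges of `H` other than those of the cycle `f` meet the cycle. -/
def IsDetached (H : SimpleGraph V) (f : ZMod n → V) : Prop :=
  ∀ i y, H.Adj (f i) y → y = f (i + 1) ∨ y = f (i - 1)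

theorem IsDetached.mulVec_apply (hd : IsDetached H f) (hf : IsCyclicEmbedding H f)
    (z : V → ℂ) (i : ZMod n) :
    (gainMatrix W H *ᵥ z) (f i) = (W (f i) (f (i + 1)) : ℂ) * z (f (i + 1)) +
      (W (f i) (f (i - 1)) : ℂ) * z (f (i - 1)) := by
  classical
  rw [gainMatrix_mulVec, Finset.sum_eq_add (f (i + 1)) (f (i - 1)) (hf.add_one_ne_sub_one i),
    if_pos (hf.adj i), if_pos (hf.adj_sub_one i)]
  · intro y _ hy
    rw [if_neg]
    intro h
    rcases hd i y h with h | h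
    exacts [hy.1 h, hy.2 h]
  · simp
  · simp

theorem IsDetached.mulVec_extend_eq_zero (hd : IsDetached H f) (hf : IsCyclicEmbedding H f)
    (Z : ZMod n → ℂ) (hZ : ∀ i, (W (f i) (f (i + 1)) : ℂ) * Z (i + 1) +
      (W (f i) (f (i - 1)) : ℂ) * Z (i - 1) = 0) :
    gainMatrix W H *ᵥ Function.extend f Z 0 = 0 := by
  ext v
  by_cases hv : ∃ i, f i = v
  · obtain ⟨i, rfl⟩ := hv
    rw [hd.mulVec_apply hf, hf.injective.extend_apply, hf.injective.extend_apply, hZ i]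
    rfl
  · rw [gainMatrix_mulVec]
    refine Finset.sum_eq_zero fun j _ => ?_
    split_ifs with h
    · rw [Function.extend_apply', Pi.zero_apply, mul_zero]
      rintro ⟨k, rfl⟩
      rcases hd k v h.symm with h | h
      exacts [hv ⟨_, h.symm⟩, hv ⟨_, h.symm⟩]
    · rfl

/-- The kernels before and after isolating the cycle share the vectors vanishing on it. After
isolation the values on the cycle are free, contributing n dimensions; before, they contribute the
restriction of the kernel. -/
theorem IsDetached.gainRank_add_finrank (hd : IsDetached H f) (hf : IsCyclicEmbedding H f)
    (W : V → V → Circle) :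
    gainRank W H + finrank ℂ ((LinearMap.ker (gainMatrix W H).mulVecLin).map
      (LinearMap.funLeft ℂ ℂ f)) = gainRank W (isolate (Set.range f) H) + n := by
  have h3 := hf.three_le
  have : NeZero n := ⟨by omega⟩
  set N := LinearMap.ker (gainMatrix W H).mulVecLin with hN
  set N' := LinearMap.ker (gainMatrix W (isolate (Set.range f) H)).mulVecLin with hN'
  set r : (V → ℂ) →ₗ[ℂ] (ZMod n → ℂ) := LinearMap.funLeft ℂ ℂ f
  have h1 : N ⊓ LinearMap.ker r = N' ⊓ LinearMap.ker r := by
    ext z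
    simp only [Submodule.mem_inf]
    refine and_congr_left fun hz => ?_
    have hz' : ∀ i, z (f i) = 0 := fun i => congrFun hz i
    have : gainMatrix W H *ᵥ z = gainMatrix W (isolate (Set.range f) H) *ᵥ z := by
      ext v
      rw [gainMatrix_mulVec, gainMatrix_mulVec]
      refine Finset.sum_congr rfl fun j _ => ?_
      by_cases hj : j ∈ Set.range f
      · obtain ⟨k, rfl⟩ := hj
        simp [hz']
      · by_cases h : H.Adj v j
        · have hv : v ∉ Set.range f := by
            rintro ⟨k, rfl⟩
            rcases hd k j h with rfl | rfl
            exacts [hj ⟨_, rfl⟩, hj ⟨_, rfl⟩]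
          have h' : (isolate (Set.range f) H).Adj v j := ⟨h, hv, hj⟩
          rw [if_pos h, if_pos h']
        · rw [if_neg h, if_neg fun h' => h (isolate_le _ _ h')]
    simp only [hN, hN', LinearMap.mem_ker, mulVecLin_apply, this]
  have h2 : N'.map r = ⊤ := by
    rw [eq_top_iff]
    intro Z _
    refine ⟨Function.extend f Z 0, ?_, ?_⟩
    · change gainMatrix W (isolate (Set.range f) H) *ᵥ Function.extend f Z 0 = 0
      ext v
      rw [gainMatrix_mulVec]
      refine Finset.sum_eq_zero fun j _ => ?_
      split_ifs with h
      · rw [Function.extend_apply', Pi.zero_apply, mul_zero]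
        exact h.2.2
      · rfl
    · ext i
      exact hf.injective.extend_apply _ _ _
  have h4 := finrank_inf_ker_add_finrank_map N r
  have h5 := finrank_inf_ker_add_finrank_map N' r
  rw [h2, finrank_top, finrank_pi, ZMod.card, ← h1] at h5
  have h6 := rank_add_finrank_ker (gainMatrix W H)
  have h7 := rank_add_finrank_ker (gainMatrix W (isolate (Set.range f) H))
  change _ + finrank ℂ N = _ at h6
  change _ + finrank ℂ N' = _ at h7
  simp only [gainRank]
  omega

theorem IsDetached.gainRank_one_add_two (hd : IsDetached H f) (hf : IsCyclicEmbedding H f)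
    (hn : 4 ∣ n) : gainRank 1 H + 2 = gainRank 1 (isolate (Set.range f) H) + n := by
  have h3 := hf.three_le
  have : NeZero n := ⟨by omega⟩
  suffices h : (LinearMap.ker (gainMatrix 1 H).mulVecLin).map (LinearMap.funLeft ℂ ℂ f) =
      alternatingVectors n by
    rw [← hd.gainRank_add_finrank hf 1, h, finrank_alternatingVectors hn]
  ext Z
  constructor
  · rintro ⟨z, hz, rfl⟩ i
    have h : (gainMatrix 1 H *ᵥ z) (f i) = 0 := congrFun hz (f i)
    rw [hd.mulVec_apply hf] at h
    simpa using h
  · intro hZ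
    refine ⟨Function.extend f Z 0, hd.mulVec_extend_eq_zero hf Z fun i => ?_, ?_⟩
    · simpa using hZ i
    · ext i
      exact hf.injective.extend_apply _ _ _

theorem UpperOptimal.four_dvd_and_prod_ne_of_isDetached [NeZero n] (hH : UpperOptimal W H)
    (hW : IsSkew W) (hf : IsCyclicEmbedding H f) (hd : IsDetached H f) :
    4 ∣ n ∧ ∏ i, W (f i) (f (i + 1)) ≠ 1 := by
  obtain ⟨-, h1, h2, -⟩ := hH.isolate_of_isCyclicEmbedding hW hf 0
  have e1 : ∀ k : ℕ, ((k + 1 : ℕ) : ZMod n) + 1 = ((k + 2 : ℕ) : ZMod n) := fun k => by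
    push_cast; ring
  have e2 : ∀ k : ℕ, ((k + 1 : ℕ) : ZMod n) - 1 = ((k : ℕ) : ZMod n) := fun k => by
    push_cast; ring
  have h4 : 4 ∣ n := by
    obtain ⟨z, hz, hne⟩ := (gainRank_eq_isolate_iff isSkew_one H (f 0)).1 h1
    have hstep : ∀ k : ℕ, z (f (k + 2 : ℕ)) = -z (f k) := by
      intro k
      have := congrFun hz (f (k + 1 : ℕ))
      rw [hd.mulVec_apply hf, e1, e2] at this
      simp only [Pi.one_apply, Circle.coe_one, one_mul, Pi.zero_apply] at this
      linear_combination this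
    have hpow : ∀ k : ℕ, z (f (2 * k : ℕ)) = (-1) ^ k * z (f 0) := by
      intro k
      induction k with
      | zero => simp
      | succ k ih =>
        rw [show 2 * (k + 1) = 2 * k + 2 by ring, hstep, ih, pow_succ]
        ring
    have hone : ∀ k, z (f (2 * k : ℕ)) = z (f 0) → Even k := by
      intro k hk
      rw [hpow] at hk
      by_contra hodd
      rw [Nat.not_even_iff_odd] at hodd
      rw [hodd.neg_one_pow] at hk
      exact hne (by linear_combination -hk / 2)
    -- Going twice around the cycle shows that n is even, and then going once around shows that n /
    -- 2 is even.
    have hn : Even n := hone n (by push_cast; simp)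
    obtain ⟨m, rfl⟩ := hn
    obtain ⟨r, rfl⟩ := hone m (by rw [two_mul]; simp only [ZMod.natCast_self])
    exact ⟨r, by ring⟩
  refine ⟨h4, fun hprod => ?_⟩
  -- If the gain of the cycle is 1, the partial products h switch all its gains to 1. Then i^k · h k
  -- is a kernel vector of A(Φ), nonzero at f 0, so deleting f 0 would not lower the gain rank.
  set g : ℕ → Circle := fun k => W (f k) (f (k + 1 : ℕ)) with hg
  set h : ℕ → Circle := fun k => ∏ j ∈ Finset.range k, (g j)⁻¹ with hh
  have hhn : h n = 1 := by
    rw [prod_zmod_eq_prod_range] at hprod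
    simp only [hh, Finset.prod_inv_distrib, inv_eq_one, hg]
    push_cast
    exact hprod
  have hper : ∀ k, h (k + n) = h k := by
    intro k
    have : h (n + k) = h k := by
      simp only [hh]
      rw [Finset.prod_range_add]
      have e : ∏ x ∈ Finset.range n, (g x)⁻¹ = 1 := hhn
      rw [e, one_mul]
      refine Finset.prod_congr rfl fun j _ => ?_
      simp [hg]
    rw [add_comm, this]
  obtain ⟨m, hm⟩ := h4
  set F : ℕ → ℂ := fun k => Complex.I ^ k * (h k : ℂ) with hF
  have hFper : ∀ k, F (k + n) = F k := by
    intro k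
    simp only [hF, hper]
    rw [hm, pow_add, pow_mul, Complex.I_pow_four, one_pow, mul_one]
  have hval := apply_val_natCast_of_periodic hFper
  have hker := hd.mulVec_extend_eq_zero (W := W) hf (fun i => F i.val) (fun i => by
    obtain ⟨k, rfl⟩ := exists_natCast_add_one_eq i
    simp only [e1, e2, hval]
    have a1 : W (f (k + 1 : ℕ)) (f (k + 2 : ℕ)) = g (k + 1) := rfl
    have a2 : W (f (k + 1 : ℕ)) (f k) = (g k)⁻¹ := hW _ _
    have a3 : h (k + 2) = h k * (g k)⁻¹ * (g (k + 1))⁻¹ := by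
      simp only [hh, Finset.prod_range_succ]
    rw [a1, a2]
    simp only [hF, a3, pow_add, Complex.I_sq]
    push_cast
    have hne : (g (k + 1) : ℂ) ≠ 0 := Circle.coe_ne_zero _
    field_simp
    ring)
  have := (gainRank_eq_isolate_iff hW H (f 0)).2 ⟨_, hker, by
    rw [hf.injective.extend_apply]
    simp [hF, hh]⟩
  omega

/-- Vertices off the cycle are deleted until it is detached. If H − f i is a forest, it has a
signing and a neighbour y of f i can go. Otherwise H − f i contains a cycle disjoint from f, one of
whose vertices can go. No parity of other cycles is presupposed. -/
theorem UpperOptimal.four_dvd_and_prod_ne [NeZero n] (hH : UpperOptimal W H)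
    (hW : IsSkew W) (hf : IsCyclicEmbedding H f) :
    4 ∣ n ∧ ∏ i, W (f i) (f (i + 1)) ≠ 1 := by
  classical
  induction H using WellFoundedLT.induction with
  | _ H ih =>
    by_cases hd : IsDetached H f
    · exact hH.four_dvd_and_prod_ne_of_isDetached hW hf hd
    simp only [IsDetached, not_forall, not_or] at hd
    obtain ⟨i, y, hy, h1, h2⟩ := hd
    by_cases hac : (isolate {f i} H).IsAcyclic
    · obtain ⟨s, hs⟩ := exists_isSigning _ fun v c hc => absurd hc (hac c)
      obtain ⟨⟨hr, hopt⟩, -⟩ := hH.boundary hW hf hy h1 h2 hs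
      refine ih _ (isolate_singleton_lt hy.symm) hopt (hf.isolate ?_)
      -- Were y on the cycle, deleting it would keep the ordinary rank instead of lowering it by 2.
      rintro k rfl
      have := (hH.isolate_of_isCyclicEmbedding hW hf k).2.1
      omega
    · simp only [IsAcyclic, not_forall, not_not] at hac
      obtain ⟨v, c, hc⟩ := hac
      obtain ⟨g, hg, -⟩ := exists_isCyclicEmbedding c hc
      have hgH : IsCyclicEmbedding H g := hg.mono fun j => (hg.adj j).1
      refine ih _ (isolate_singleton_lt (hgH.adj 0))
        (hH.isolate_of_isCyclicEmbedding hW hgH 0).1 (hf.isolate ?_)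
      -- A cycle meeting f contains every vertex of f, but g avoids f i.
      intro k hk
      obtain ⟨l, hl⟩ := hH.range_subset_of_eq hW hf hgH (i := k) (j := 0) hk i
      exact (hg.adj l).2.1 hl.symm

/-- Edges leaving the cycle are deleted one at a time, keeping r(G) and upper-optimality, until the
cycle is detached. -/
theorem UpperOptimal.isolate_range (hH : UpperOptimal W H) (hW : IsSkew W)
    (hf : IsCyclicEmbedding H f) {s : V → ℂ} (hs : IsSigning H s) :
    gainRank 1 H + 2 = gainRank 1 (isolate (Set.range f) H) + n ∧
      UpperOptimal W (isolate (Set.range f) H) := by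
  classical
  have h3 := hf.three_le
  have : NeZero n := ⟨by omega⟩
  induction H using WellFoundedLT.induction with
  | _ H ih =>
    by_cases hd : IsDetached H f
    · have h1 := hd.gainRank_one_add_two hf (hH.four_dvd_and_prod_ne hW hf).1
      -- The ordinary rank falls by n − 2, θ by at least 1, and the gain rank by at most n.
      refine ⟨h1, upperOptimal_of_le hW ?_⟩
      have h2 := hd.gainRank_add_finrank hf W
      have h4 := hf.cyclomaticNumber_isolate_add_one_le 0
      have h5 : cyclomaticNumber (isolate (Set.range f) H) ≤
          cyclomaticNumber (isolate {f 0} H) :=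
        cyclomaticNumber_mono fun a b h => ⟨h.1, fun ha => h.2.1 ⟨0, ha.symm⟩,
          fun hb => h.2.2 ⟨0, hb.symm⟩⟩
      unfold UpperOptimal at hH
      omega
    simp only [IsDetached, not_forall, not_or] at hd
    obtain ⟨i, y, hy, h1, h2⟩ := hd
    obtain ⟨-, hr, hopt⟩ := hH.boundary hW hf hy h1 h2 (hs.mono (isolate_le _ _))
    have hlt : H.deleteEdges {s(f i, y)} < H := by
      refine lt_of_le_of_ne (deleteEdges_le _) fun he => ?_
      have := he.ge hy
      rw [deleteEdges_adj] at this
      exact this.2 rfl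
    have := ih _ hlt hopt (hf.mono fun k => by
      rw [deleteEdges_adj]
      refine ⟨hf.adj k, fun he => ?_⟩
      rcases Sym2.eq_iff.1 he with ⟨ha, hb⟩ | ⟨ha, hb⟩
      · rw [hf.injective ha] at hb
        exact h1 hb.symm
      · have := hf.injective hb
        rw [← this, add_sub_cancel_right] at h2
        exact h2 ha.symm) (hs.mono hlt.le)
    rwa [isolate_deleteEdges (Set.mem_range_self i), hr] at this

end CycleRank

/-! ### Comparison of G, the contraction T and its core Γ. -/

section Contraction

open SimpleGraph Matrix

variable {V : Type*}

theorem graphRank_eq_gainRank_one [Fintype V] (G : SimpleGraph V) :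
    graphRank G = gainRank 1 G := by
  classical
  rw [graphRank, gainRank, Subsingleton.elim (Fintype.ofFinite V) ‹Fintype V›]
  congr 1

theorem gainMatrix_one_submatrix {U : Type*} (g : U → V) {L : SimpleGraph U} {H : SimpleGraph V}
    (h : ∀ a b, L.Adj a b ↔ H.Adj (g a) (g b)) :
    (gainMatrix 1 H).submatrix g g = gainMatrix 1 L := by
  ext a b
  rw [submatrix_apply]
  by_cases hab : L.Adj a b
  · rw [gainMatrix_of_adj 1 hab, gainMatrix_of_adj 1 ((h a b).1 hab)]
    rfl
  · rw [gainMatrix_of_not_adj 1 hab, gainMatrix_of_not_adj 1 (mt (h a b).2 hab)]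

theorem gainRank_one_le_of_comap {U : Type*} [Fintype U] [Fintype V] (g : U → V)
    {L : SimpleGraph U} {H : SimpleGraph V} (h : ∀ a b, L.Adj a b ↔ H.Adj (g a) (g b)) :
    gainRank 1 L ≤ gainRank 1 H := by
  rw [gainRank, ← gainMatrix_one_submatrix g h]
  exact rank_submatrix_le _ _ _

theorem gainRank_one_eq_of_comap {U : Type*} [Fintype U] [Fintype V] {g : U → V}
    (hg : Function.Injective g) {L : SimpleGraph U} {H : SimpleGraph V}
    (h : ∀ a b, L.Adj a b ↔ H.Adj (g a) (g b)) (hH : ∀ x y, H.Adj x y → x ∈ Set.range g) :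
    gainRank 1 L = gainRank 1 H := by
  rw [gainRank, ← gainMatrix_one_submatrix g h]
  refine rank_submatrix_eq_of_support _ g hg fun x y hxy => ?_
  have : H.Adj x y := by
    by_contra hn
    exact hxy (gainMatrix_of_not_adj 1 hn)
  exact ⟨hH x y this, hH y x this.symm⟩

theorem gainRank_one_le_isolate_finset [Fintype V] (H : SimpleGraph V) (t : Finset V) :
    gainRank 1 H ≤ gainRank 1 (isolate (t : Set V) H) + 2 * t.card := by
  classical
  induction t using Finset.induction_on with
  | empty => simp [isolate_empty]
  | insert y t hy ih =>
    have := gainRank_le_isolate_add_two isSkew_one (isolate (t : Set V) H) y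
    rw [isolate_isolate, Set.union_comm, ← Set.insert_eq, ← Finset.coe_insert] at this
    rw [Finset.card_insert_of_notMem hy]
    omega

section Family

variable [Fintype V] {W : V → V → Circle} {H : SimpleGraph V} {ι : Type*} {N : ι → ℕ}
  {f : ∀ a, ZMod (N a) → V}

theorem UpperOptimal.isolate_biUnion (hH : UpperOptimal W H) (hW : IsSkew W)
    (hf : ∀ a, IsCyclicEmbedding H (f a))
    (hdisj : ∀ a b, a ≠ b → Disjoint (Set.range (f a)) (Set.range (f b)))
    {s : V → ℂ} (hs : IsSigning H s) (t : Finset ι) :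
    UpperOptimal W (isolate (⋃ a ∈ t, Set.range (f a)) H) ∧
      (gainRank 1 H : ℤ) = gainRank 1 (isolate (⋃ a ∈ t, Set.range (f a)) H) +
        ∑ a ∈ t, ((N a : ℤ) - 2) := by
  classical
  induction t using Finset.induction_on with
  | empty => simpa [isolate_empty] using hH
  | insert a t ha ih =>
    have hfa : IsCyclicEmbedding (isolate (⋃ b ∈ t, Set.range (f b)) H) (f a) := by
      refine (hf a).isolate fun i hi => ?_
      simp only [Set.mem_iUnion] at hi
      obtain ⟨b, hb, hib⟩ := hi
      exact Set.disjoint_left.1 (hdisj a b (by rintro rfl; exact ha hb)) ⟨i, rfl⟩ hib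
    have h1 := ih.1.isolate_range hW hfa (hs.mono (isolate_le _ _))
    rw [isolate_isolate, Set.union_comm] at h1
    rw [Finset.set_biUnion_insert]
    refine ⟨h1.2, ?_⟩
    rw [Finset.sum_insert ha, ih.2]
    have := h1.1
    omega

theorem UpperOptimal.isolate_boundary (hH : UpperOptimal W H) (hW : IsSkew W)
    (hf : ∀ a, IsCyclicEmbedding H (f a)) {s : V → ℂ} (hs : IsSigning H s) (t : Finset V)
    (ht : ∀ y ∈ t, (∃ a i, H.Adj (f a i) y) ∧ ∀ a, y ∉ Set.range (f a)) :
    UpperOptimal W (isolate (t : Set V) H) ∧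
      gainRank 1 H = gainRank 1 (isolate (t : Set V) H) + 2 * t.card := by
  classical
  induction t using Finset.induction_on with
  | empty => simpa [isolate_empty] using hH
  | insert y t hy ih =>
    obtain ⟨hopt, hr⟩ := ih fun x hx => ht x (Finset.mem_insert_of_mem hx)
    obtain ⟨⟨a, i, hadj⟩, hnot⟩ := ht y (Finset.mem_insert_self _ _)
    have hft : ∀ i, f a i ∉ (t : Set V) := fun i hi =>
      (ht _ (Finset.mem_insert_of_mem hi)).2 a ⟨i, rfl⟩
    obtain ⟨⟨h1, h2⟩, -⟩ := hopt.boundary hW ((hf a).isolate hft) (i := i) (y := y)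
      ⟨hadj, hft i, hy⟩ (fun h => hnot a ⟨_, h.symm⟩) (fun h => hnot a ⟨_, h.symm⟩)
      (hs.mono ((isolate_le _ _).trans (isolate_le _ _)))
    rw [isolate_isolate, Set.union_comm, ← Set.insert_eq, ← Finset.coe_insert] at h1 h2
    refine ⟨h2, ?_⟩
    rw [Finset.card_insert_of_notMem hy]
    omega

end Family

/-- The weights of the gain function, extended by `1` to non-adjacent pairs. -/
noncomputable def GainFunction.weight {G : SimpleGraph V} (φ : GainFunction G) (i j : V) :
    Circle :=
  open Classical in
  if h : G.Adj i j then φ.gain ⟨(i, j), h⟩ else 1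

section Gain

variable {G : SimpleGraph V} (φ : GainFunction G)

theorem GainFunction.weight_of_adj {i j : V} (h : G.Adj i j) :
    φ.weight i j = φ.gain ⟨(i, j), h⟩ := dif_pos h

theorem GainFunction.isSkew_weight : IsSkew φ.weight := by
  intro i j
  by_cases h : G.Adj i j
  · rw [φ.weight_of_adj h, φ.weight_of_adj h.symm]
    exact φ.gain_symm ⟨(i, j), h⟩
  · rw [GainFunction.weight, GainFunction.weight, dif_neg h, dif_neg fun h' => h h'.symm, inv_one]

theorem GainFunction.rank_eq_gainRank [Fintype V] : φ.rank = gainRank φ.weight G := by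
  rw [GainFunction.rank, gainRank, Subsingleton.elim (Fintype.ofFinite V) ‹Fintype V›]
  congr 1
  ext i j
  by_cases h : G.Adj i j
  · rw [gainMatrix_of_adj _ h, φ.weight_of_adj h]
    simp [GainFunction.adjMatrix, h]
  · rw [gainMatrix_of_not_adj _ h]
    simp [GainFunction.adjMatrix, h]

theorem GainFunction.walkGain_eq_prod {u v : V} (c : G.Walk u v) :
    φ.walkGain c = (c.darts.map fun d => φ.weight d.fst d.snd).prod := by
  rw [GainFunction.walkGain]
  congr 1
  refine List.map_congr_left fun d _ => ?_
  rw [φ.weight_of_adj d.adj]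

end Gain

section Main

variable [Fintype V] {W : V → V → Circle} {G : SimpleGraph V}

theorem UpperOptimal.eq_of_mem_verts (hG : UpperOptimal W G) (hW : IsSkew W) {O₁ O₂ : G.Subgraph}
    (h₁ : O₁ ∈ cycles G) (h₂ : O₂ ∈ cycles G) {x : V} (hx₁ : x ∈ O₁.verts) (hx₂ : x ∈ O₂.verts) :
    O₁ = O₂ := by
  obtain ⟨v, c, hc, rfl⟩ := h₁
  obtain ⟨w, d, hd, rfl⟩ := h₂
  obtain ⟨f, hf, hfv, hfa, -⟩ := exists_isCyclicEmbedding c hc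
  obtain ⟨g, hg, hgv, hga, -⟩ := exists_isCyclicEmbedding d hd
  rw [hfv] at hx₁
  rw [hgv] at hx₂
  obtain ⟨i, rfl⟩ := hx₁
  obtain ⟨j, hij⟩ := hx₂
  refine Subgraph.ext ?_ ?_
  · rw [hfv, hgv]
    refine Set.Subset.antisymm ?_ ?_
    · rintro _ ⟨k, rfl⟩
      obtain ⟨l, hl⟩ := hG.range_subset_of_eq hW hf hg hij.symm k
      exact ⟨l, hl.symm⟩
    · rintro _ ⟨k, rfl⟩
      obtain ⟨l, hl⟩ := hG.range_subset_of_eq hW hg hf hij k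
      exact ⟨l, hl.symm⟩
  · ext a b
    rw [hfa, hga]
    constructor
    · rintro ⟨k, hk⟩
      obtain ⟨l, hl⟩ := hG.edge_eq_of_eq hW hf hg hij.symm k
      exact ⟨l, hl.symm.trans hk⟩
    · rintro ⟨k, hk⟩
      obtain ⟨l, hl⟩ := hG.edge_eq_of_eq hW hg hf hij k
      exact ⟨l, hl.symm.trans hk⟩

/-- As an outside neighbour of f, the vertex g j would lower r(G) by 2 when deleted; as a vertex of
the cycle g, it does not lower it. -/
theorem UpperOptimal.not_adj_of_disjoint_range (hG : UpperOptimal W G) (hW : IsSkew W)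
    {s : V → ℂ} (hs : IsSigning G s) {n m : ℕ} {f : ZMod n → V} {g : ZMod m → V}
    (hf : IsCyclicEmbedding G f) (hg : IsCyclicEmbedding G g)
    (hdisj : Disjoint (Set.range f) (Set.range g)) (i : ZMod n) (j : ZMod m) :
    ¬ G.Adj (f i) (g j) := by
  classical
  intro h
  have hne : ∀ k, g j ≠ f k := fun k hk => Set.disjoint_left.1 hdisj ⟨k, rfl⟩ ⟨j, hk⟩
  have h1 := (hG.boundary hW hf h (hne _) (hne _) (hs.mono (isolate_le _ _))).1.1
  have h2 := (hG.isolate_of_isCyclicEmbedding hW hg j).2.1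
  omega

theorem UpperOptimal.rank_contraction (hG : UpperOptimal W G) (hW : IsSkew W)
    {s : V → ℂ} (hs : IsSigning G s) :
    (graphRank G : ℤ) = (graphRank (contraction G) : ℤ) +
      ∑ O : cycles G, ((O.1.verts.ncard : ℤ) - 2) ∧
    graphRank (contraction G) = graphRank (contractionCore G) := by
  classical
  have hex : ∀ O : cycles G, ∃ (n : ℕ) (f : ZMod n → V), IsCyclicEmbedding G f ∧
      O.1.verts = Set.range f := by
    rintro ⟨_, v, c, hc, rfl⟩
    obtain ⟨f, hf, hfv, -⟩ := exists_isCyclicEmbedding c hc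
    exact ⟨_, f, hf, hfv⟩
  choose N f hf hv using hex
  have hcard : ∀ O : cycles G, O.1.verts.ncard = N O := by
    intro O
    rw [hv, ← Set.image_univ, Set.ncard_image_of_injective _ (hf O).injective, Set.ncard_univ,
      Nat.card_zmod]
  have hdisj : ∀ a b : cycles G, a ≠ b → Disjoint (Set.range (f a)) (Set.range (f b)) := by
    intro a b hab
    rw [Set.disjoint_left]
    intro x hxa hxb
    rw [← hv] at hxa hxb
    exact hab (Subtype.ext (hG.eq_of_mem_verts hW a.2 b.2 hxa hxb))
  set K : Set V := ⋃ a ∈ (Finset.univ : Finset (cycles G)), Set.range (f a) with hK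
  have hKoff : ∀ x, x ∈ offCycle G ↔ x ∉ K := by
    intro x
    simp only [hK, offCycle, Set.mem_ofPred_eq, Finset.mem_univ, Set.iUnion_true, Set.mem_iUnion,
      not_exists, ← hv]
    exact ⟨fun h O => h O.1 O.2, fun h O hO => h ⟨O, hO⟩⟩
  set B : Finset V :=
    {y | (∃ a i, G.Adj (f a i) y) ∧ ∀ a, y ∉ Set.range (f a)} with hB
  obtain ⟨hBopt, hBr⟩ := hG.isolate_boundary hW hf hs B fun y hy => by simpa [hB] using hy
  obtain ⟨-, hKr⟩ := hG.isolate_biUnion hW hf hdisj hs Finset.univ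
  -- B avoids the cycles, so they survive in G−B and removing them costs the same sum as in G.
  obtain ⟨-, hKBr⟩ := hBopt.isolate_biUnion hW
    (fun a => (hf a).isolate fun i hi => by
      have : f a i ∈ B := hi
      simp only [hB, Finset.mem_filter] at this
      exact this.2.2 a ⟨i, rfl⟩) hdisj (hs.mono (isolate_le _ _)) Finset.univ
  rw [← hK] at hKr hKBr
  have : Fintype (offCycle G) := Fintype.ofFinite _
  have : Fintype ((Set.range (Sum.inr : cycles G → offCycle G ⊕ cycles G))ᶜ : Set _) :=
    Fintype.ofFinite _
  have hinl : Function.Injective (Sum.inl : offCycle G → offCycle G ⊕ cycles G) :=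
    Sum.inl_injective
  have hoff : ∀ (H : SimpleGraph V) x y, (isolate K H).Adj x y →
      x ∈ Set.range (Subtype.val : offCycle G → V) := fun H x y h =>
    ⟨⟨x, (hKoff x).2 h.2.1⟩, rfl⟩
  have hoffadj : ∀ (H : SimpleGraph V) (a b : offCycle G),
      (H.induce (offCycle G)).Adj a b ↔ (isolate K H).Adj a b := fun H a b =>
    ⟨fun h => ⟨h, (hKoff _).1 a.2, (hKoff _).1 b.2⟩, fun h => h.1⟩
  have hcore : gainRank 1 (contractionCore G) = gainRank 1 (isolate K G) := by
    set T' := isolate (Set.range (Sum.inr : cycles G → offCycle G ⊕ cycles G)) (contraction G)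
    have e1 : gainRank 1 (contractionCore G) = gainRank 1 T' :=
      gainRank_one_eq_of_comap Subtype.val_injective
        (fun a b => ⟨fun h => ⟨h, a.2, b.2⟩, fun h => h.1⟩)
        (fun x y h => ⟨⟨x, h.2.1⟩, rfl⟩)
    have e2 : gainRank 1 (G.induce (offCycle G)) = gainRank 1 T' := by
      refine gainRank_one_eq_of_comap hinl
        (fun a b => ⟨fun h => ⟨h, by simp, by simp⟩, fun h => h.1⟩) ?_
      rintro (u | O) y h
      · exact ⟨u, rfl⟩
      · exact absurd ⟨O, rfl⟩ h.2.1
    rw [e1, ← e2]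
    exact gainRank_one_eq_of_comap Subtype.val_injective (hoffadj G) (hoff G)
  have hle : gainRank 1 (contractionCore G) ≤ gainRank 1 (contraction G) :=
    gainRank_one_le_of_comap Subtype.val fun _ _ => Iff.rfl
  have hBoff : ∀ y ∈ B, y ∈ offCycle G := by
    intro y hy
    rw [hKoff]
    simp only [hB, Finset.mem_filter] at hy
    simpa [hK] using hy.2.2
  set B' : Finset (offCycle G ⊕ cycles G) :=
    Finset.univ.filter fun x => ∃ u : offCycle G, x = Sum.inl u ∧ u.1 ∈ B with hB'
  have hB'card : B'.card ≤ B.card := by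
    refine Finset.card_le_card_of_injOn
      (fun x => Sum.elim (fun u => u.1) (fun O => f O 0) x) ?_ ?_
    · intro x hx
      simp only [hB', Finset.coe_filter, Finset.mem_univ, true_and, Set.mem_ofPred_eq] at hx
      obtain ⟨u, rfl, hu⟩ := hx
      exact hu
    · intro x hx y hy hxy
      simp only [hB', Finset.coe_filter, Finset.mem_univ, true_and, Set.mem_ofPred_eq] at hx hy
      obtain ⟨u, rfl, hu⟩ := hx
      obtain ⟨w, rfl, hw⟩ := hy
      exact congrArg Sum.inl (Subtype.ext hxy)
  have hB'mem : ∀ u : offCycle G, Sum.inl u ∈ (B' : Set (offCycle G ⊕ cycles G)) ↔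
      u.1 ∈ (B : Set V) := by
    intro u
    simp [hB']
  have hTle := gainRank_one_le_isolate_finset (contraction G) B'
  -- In T−B every contracted vertex is isolated: its off-cycle neighbours lie in B, and distinct
  -- cycles are not adjacent.
  have hT : gainRank 1 (isolate (B' : Set (offCycle G ⊕ cycles G)) (contraction G)) =
      gainRank 1 (isolate K (isolate (B : Set V) G)) := by
    rw [← gainRank_one_eq_of_comap Subtype.val_injective (hoffadj (isolate (B : Set V) G))
      (hoff (isolate (B : Set V) G))]
    symm
    refine gainRank_one_eq_of_comap hinl (fun a b => ?_) ?_
    · rw [isolate_adj, hB'mem, hB'mem]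
      exact Iff.rfl
    · rintro (u | O) y h
      · exact ⟨u, rfl⟩
      · exfalso
        obtain ⟨hadj, -, hy⟩ := h
        rcases y with w | P
        · obtain ⟨x, hx, hwx⟩ := hadj
          rw [hv] at hx
          obtain ⟨i, rfl⟩ := hx
          rw [hB'mem] at hy
          refine hy ?_
          have hwK := (hKoff w).1 w.2
          simp only [hB, Finset.coe_filter, Finset.mem_univ, true_and, Set.mem_ofPred_eq]
          refine ⟨⟨O, i, hwx.symm⟩, ?_⟩
          simpa [hK] using hwK
        · obtain ⟨hne, x, hx, z, hz, hxz⟩ := hadj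
          rw [hv] at hx hz
          obtain ⟨i, rfl⟩ := hx
          obtain ⟨j, rfl⟩ := hz
          exact hG.not_adj_of_disjoint_range hW hs (hf O) (hf P) (hdisj O P hne) i j hxz
  rw [graphRank_eq_gainRank_one, graphRank_eq_gainRank_one, graphRank_eq_gainRank_one]
  simp only [hcard]
  -- From `hBr`, `hKr` and `hKBr`, r(G−K) = r(G−B−K) + 2|B|. This is r(Γ) by `hcore`, and it bounds
  -- r(T) from above by `hTle`, `hT` and `hB'card`; `hle` is the reverse bound.
  omega

end Main

end Contraction

end UnitGain

theorem theorem4p7 {V : Type*} [Finite V] (G : SimpleGraph V) (φ : UnitGain.GainFunction G)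
    (hφ : φ.IsUpperOptimal) :
    (∀ O₁ ∈ UnitGain.cycles G, ∀ O₂ ∈ UnitGain.cycles G, O₁ ≠ O₂ →
      Disjoint O₁.verts O₂.verts) ∧
    (∀ (v : V) (c : G.Walk v v), c.IsCycle → φ.IsTypeB c ∧ c.length ≡ 0 [MOD 4]) ∧
    (UnitGain.graphRank G : ℤ) = (UnitGain.graphRank (UnitGain.contraction G) : ℤ) +
      ∑ O : UnitGain.cycles G, ((O.1.verts.ncard : ℤ) - 2) ∧
    UnitGain.graphRank (UnitGain.contraction G) =
      UnitGain.graphRank (UnitGain.contractionCore G) := by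
  have : Fintype V := Fintype.ofFinite V
  have hW := φ.isSkew_weight
  have hG : UnitGain.UpperOptimal φ.weight G := by
    rw [UnitGain.GainFunction.IsUpperOptimal, φ.rank_eq_gainRank,
      UnitGain.graphRank_eq_gainRank_one] at hφ
    exact hφ
  have hcyc : ∀ (v : V) (c : G.Walk v v), c.IsCycle → 4 ∣ c.length ∧ φ.walkGain c ≠ 1 := by
    intro v c hc
    have : NeZero c.length := ⟨by have := hc.three_le_length; omega⟩
    obtain ⟨f, hf, -, -, hprod⟩ := UnitGain.exists_isCyclicEmbedding c hc
    rw [φ.walkGain_eq_prod, hprod]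
    exact hG.four_dvd_and_prod_ne hW hf
  refine ⟨?_, ?_, ?_⟩
  · intro O₁ h₁ O₂ h₂ hne
    rw [Set.disjoint_left]
    exact fun x hx₁ hx₂ => hne (hG.eq_of_mem_verts hW h₁ h₂ hx₁ hx₂)
  · intro v c hc
    obtain ⟨⟨m, hm⟩, hne⟩ := hcyc v c hc
    refine ⟨⟨⟨2 * m, by omega⟩, ?_⟩, ?_⟩
    -- For length 4m the excluded value (−1)^(2m) is 1, so Type B means that the gain is not 1.
    · rw [hm, show 4 * m / 2 = 2 * m by omega, pow_mul, neg_one_sq, one_pow]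
      exact fun h => hne (Circle.ext (by simpa using h))
    · rw [hm]
      exact (Nat.modEq_zero_iff_dvd).2 ⟨m, rfl⟩
  · obtain ⟨s, hs⟩ := UnitGain.exists_isSigning G fun v c hc => by
      obtain ⟨m, hm⟩ := (hcyc v c hc).1
      exact ⟨2 * m, by omega⟩
    exact hG.rank_contraction hW hs
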